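/- Theorem 1. For a binary form $F(X,Y)=a_0X^n+a_1X^{n-1}Y+\cdots+a_nY^n$ let $A_F\in[0,\infty]$ denote the area (Lebesgue measure) of the region $\{(x,y)\in\mathbb R^2 : |F(x,y)|\le 1\}$, and, for a factorization $F=\prod_{i=1}^n(\alpha_iX-\beta_iY)$ over $\mathbb C$, let $D_F=\prod_{i<j}(\alpha_i\beta_j-\alpha_j\beta_i)^2$ be its discriminant. Let $B$ denote the Beta function. If $F$ is a binary form with integer coefficients, degree $n\ge 3$ and $D_F\ne 0$, then $$A_F\le 3B\left(\tfrac13,\tfrac13\right).$$ Equality holds for every form equivalent under $GL_2(\mathbb Z)$ to $XY(X-Y)$, that is, for every form $G(X,Y)=H(aX+bY,cX+dY)$ with $H(X,Y)=XY(X-Y)$ and $\begin{pmatrix}a&b\\c&d\end{pmatrix}\in GL_2(\mathbb Z)$; each such $G$ is an integer cubic form with non-zero discriminant. Moreover, $3B(\tfrac13,\tfrac13)=15.8997$ to four decimal places, that is, $|3B(\tfrac13,\tfrac13)-15.8997|<0.00005$. -/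

import Mathlib

open MvPolynomial

/-- `D` is the discriminant of the form `F` of degree `n` over `ℂ`: for a factorization
`F = ∏ i, (α i * X - β i * Y)` into linear forms, `D = ∏_{i < j} (α i * β j - α j * β i) ^ 2`.
(Every complex binary form of degree `n ≥ 1` has such a factorization, and the value of `D`
does not depend on which one is taken.) -/
def IsDiscriminant (n : ℕ) (F : MvPolynomial (Fin 2) ℂ) (D : ℂ) : Prop :=
  ∃ α β : Fin n → ℂ,
    F = ∏ i, (C (α i) * X 0 - C (β i) * X 1) ∧
    D = ∏ i, ∏ j ∈ Finset.Ioi i, (α i * β j - α j * β i) ^ 2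

/-- The binary form `F`, of degree `n` and with integer coefficients, has non-zero
discriminant. -/
def HasNonzeroDiscriminant (n : ℕ) (F : MvPolynomial (Fin 2) ℤ) : Prop :=
  ∃ D : ℂ, IsDiscriminant n (map (Int.castRingHom ℂ) F) D ∧ D ≠ 0

/-- The area `A_F` of the region `|F(x, y)| ≤ 1` in the real plane, possibly infinite. -/
noncomputable def formArea (F : MvPolynomial (Fin 2) ℤ) : ENNReal :=
  MeasureTheory.volume {v : Fin 2 → ℝ | |aeval v F| ≤ 1}

/-- The form `F_T(X, Y) = F(a X + b Y, c X + d Y)` for `T = !![a, b; c, d]`. -/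
noncomputable def formSubst (T : Matrix (Fin 2) (Fin 2) ℤ) (F : MvPolynomial (Fin 2) ℤ) :
    MvPolynomial (Fin 2) ℤ :=
  aeval ![C (T 0 0) * X 0 + C (T 0 1) * X 1, C (T 1 0) * X 0 + C (T 1 1) * X 1] F

/-- Equivalence of integer forms under `GL₂(ℤ)`: `G = F_T` for some `T`. -/
def GL2ZEquivalent (F G : MvPolynomial (Fin 2) ℤ) : Prop :=
  ∃ T : Matrix.GeneralLinearGroup (Fin 2) ℤ, G = formSubst T.val F

open MeasureTheory

/-! Slicing along lines through the origin gives `A_F = ∫ |F(s,1)|^(-2/n) ds`, which is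
multiplicative in the complex linear factors of `F`. The bound then rests on three facts.

Integrality: `D_F` is a non-zero integer, so `|D_F| ≥ 1` (`one_le_norm_prod_wedge`).

Reduction to cubics: to each triple of factors attach the integrand of its cubic, normalized by the
discriminant. The geometric mean of these over all permutations of the factors is `|F(s,1)|^(-2/n)`
times a power of `|D_F|`, so Hölder's inequality bounds `A_F` by the largest normalized cubic
integral (`volume_prod_wedge_le_of_one_le_discr`).

Complex cubics: replace a factor `l` by `u l̄ + l` with `|u| = 1`. At real points `|l̄| = |l|`, so
the mean of `log |u l̄ + l|` over `u` equals `log |l|`, while the mean logarithm of a determinant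
with another factor can only grow. By Jensen the normalized integral is at most its average over `u`
(`tripleIntegral_le_circle_lintegral`), and each `u l̄ + l` is proportional to a real form. Treating
the factors one at a time leaves real triples. Non-degenerate ones are all carried to `XY(X-Y)` by
linear maps, so they share one value, the area `3B(1/3,1/3)` of `|XY(X-Y)| ≤ 1`. -/

/-! ### Area of a homogeneous region as an integral over a line -/

theorem lintegral_abs_Icc_symm {R : ℝ} (hR : 0 ≤ R) :
    ∫⁻ y in Set.Icc (-R) R, ENNReal.ofReal |y| = ENNReal.ofReal (R ^ 2) := by
  rw [← ofReal_integral_eq_lintegral_ofReal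
    (continuous_abs.continuousOn.integrableOn_compact isCompact_Icc)
    (Filter.Eventually.of_forall fun y => abs_nonneg y),
    integral_Icc_eq_integral_Ioc, ← intervalIntegral.integral_of_le (by linarith)]
  congr 1
  rw [← intervalIntegral.integral_add_adjacent_intervals (b := 0)
    (continuous_abs.intervalIntegrable _ _) (continuous_abs.intervalIntegrable _ _)]
  have h1 : ∫ y in (-R)..0, |y| = ∫ y in (-R)..0, -y := by
    refine intervalIntegral.integral_congr fun y hy => ?_
    rw [Set.uIcc_of_le (by linarith)] at hy
    exact abs_of_nonpos hy.2
  have h2 : ∫ y in (0 : ℝ)..R, |y| = ∫ y in (0 : ℝ)..R, y := by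
    refine intervalIntegral.integral_congr fun y hy => ?_
    rw [Set.uIcc_of_le hR] at hy
    exact abs_of_nonneg hy.1
  rw [h1, h2, intervalIntegral.integral_neg, integral_id, integral_id]
  ring

/-- The set is `[-R, R]` with `R = c^(-1/n)`. The cases `c = 0` and `c = ⊤` agree with the
conventions for negative powers, so zeros of a form need no separate treatment later. -/
theorem lintegral_abs_setOf_pow_mul_le_one {n : ℕ} (hn : 0 < n) (c : ENNReal) :
    ∫⁻ y in {y : ℝ | ENNReal.ofReal |y| ^ n * c ≤ 1}, ENNReal.ofReal |y| =
      c ^ (-(2 / n : ℝ)) := by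
  have hn' : (0 : ℝ) < n := by exact_mod_cast hn
  rcases eq_or_ne c 0 with rfl | h0
  · rw [ENNReal.zero_rpow_of_neg (by simp only [Left.neg_neg_iff]; positivity), eq_top_iff]
    refine ENNReal.le_of_forall_nnreal_lt fun r _ => ?_
    have h := lintegral_abs_Icc_symm (R := r + 1) (by positivity)
    calc (r : ENNReal) ≤ ENNReal.ofReal ((r + 1 : ℝ) ^ 2) := by
          rw [← ENNReal.ofReal_coe_nnreal]
          exact ENNReal.ofReal_le_ofReal (by nlinarith [r.coe_nonneg])
      _ = _ := h.symm
      _ ≤ _ := lintegral_mono_set fun y _ => by simp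
  rcases eq_or_ne c ⊤ with rfl | ht
  · rw [ENNReal.top_rpow_of_neg (by simp only [Left.neg_neg_iff]; positivity)]
    have : {y : ℝ | ENNReal.ofReal |y| ^ n * ⊤ ≤ 1} ⊆ {0} := by
      intro y hy
      by_contra hy0
      have : ENNReal.ofReal |y| ^ n ≠ 0 := by
        simpa [hn.ne'] using hy0
      simp [ENNReal.mul_top this] at hy
    exact le_antisymm ((lintegral_mono_set this).trans (by simp)) bot_le
  · lift c to NNReal using ht
    have hc : 0 < (c : ℝ) := by
      have : c ≠ 0 := by exact_mod_cast h0
      positivity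
    set R : ℝ := (c : ℝ) ^ (-(1 / n : ℝ)) with hRdef
    have hR : 0 ≤ R := by positivity
    have hRn : R ^ n * c = 1 := by
      rw [hRdef, ← Real.rpow_natCast, ← Real.rpow_mul hc.le]
      have : -(1 / n : ℝ) * n = -1 := by field_simp
      rw [this, Real.rpow_neg_one, inv_mul_cancel₀ hc.ne']
    have hset : {y : ℝ | ENNReal.ofReal |y| ^ n * c ≤ 1} = Set.Icc (-R) R := by
      ext y
      rw [Set.mem_Icc, ← abs_le, Set.mem_ofPred_eq, ← ENNReal.ofReal_coe_nnreal,
        ← ENNReal.ofReal_pow (abs_nonneg y), ← ENNReal.ofReal_mul (by positivity),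
        ENNReal.ofReal_le_one, ← hRn, mul_le_mul_iff_left₀ hc,
        pow_le_pow_iff_left₀ (abs_nonneg y) hR hn.ne']
    rw [hset, lintegral_abs_Icc_symm hR, ← ENNReal.ofReal_coe_nnreal,
      ENNReal.ofReal_rpow_of_pos hc, hRdef, ← Real.rpow_natCast, ← Real.rpow_mul hc.le]
    congr 2
    push_cast
    ring

/-- Substituting `x = s y` in the slice at height `y` produces a Jacobian `|y|` and, by homogeneity,
a factor `|y|^n` in front of `f ![s, 1]`. Tonelli then allows integration over `y` first. -/
theorem volume_homogeneous_le_one {n : ℕ} (hn : 0 < n) {f : (Fin 2 → ℝ) → ENNReal}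
    (hf : Measurable f) (hhom : ∀ (c : ℝ) v, f (c • v) = ENNReal.ofReal |c| ^ n * f v) :
    volume {v | f v ≤ 1} = ∫⁻ s : ℝ, f ![s, 1] ^ (-(2 / n : ℝ)) := by
  have hmeas : Measurable fun q : ℝ × ℝ => f ![q.1, q.2] :=
    hf.comp (MeasurableEquiv.finTwoArrow (α := ℝ)).symm.measurable
  have hS : MeasurableSet {q : ℝ × ℝ | f ![q.1, q.2] ≤ 1} := measurableSet_le hmeas measurable_const
  have h1 : volume {v | f v ≤ 1} = volume {q : ℝ × ℝ | f ![q.1, q.2] ≤ 1} := by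
    rw [← (volume_preserving_finTwoArrow ℝ).symm.measure_preimage_equiv]
    rfl
  have hT : MeasurableSet {q : ℝ × ℝ | ENNReal.ofReal |q.1| ^ n * f ![q.2, 1] ≤ 1} :=
    measurableSet_le (((by fun_prop : Measurable fun q : ℝ × ℝ => ENNReal.ofReal |q.1| ^ n)).mul
      (hmeas.comp (measurable_snd.prodMk measurable_const))) measurable_const
  have hslice : ∀ y : ℝ, y ≠ 0 → volume ((fun x => (x, y)) ⁻¹' {q : ℝ × ℝ | f ![q.1, q.2] ≤ 1}) =
      ∫⁻ s : ℝ, {q : ℝ × ℝ | ENNReal.ofReal |q.1| ^ n * f ![q.2, 1] ≤ 1}.indicator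
        (fun q => ENNReal.ofReal |q.1|) (y, s) := by
    intro y hy
    have hTy : MeasurableSet {s : ℝ | ENNReal.ofReal |y| ^ n * f ![s, 1] ≤ 1} :=
      measurable_prodMk_left hT
    have e1 : ∀ s : ℝ, {q : ℝ × ℝ | ENNReal.ofReal |q.1| ^ n * f ![q.2, 1] ≤ 1}.indicator
        (fun q => ENNReal.ofReal |q.1|) (y, s) =
        {s : ℝ | ENNReal.ofReal |y| ^ n * f ![s, 1] ≤ 1}.indicator
          (fun _ => ENNReal.ofReal |y|) s := fun s => rfl
    simp_rw [e1]
    rw [lintegral_indicator hTy, setLIntegral_const]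
    have e2 : {s : ℝ | ENNReal.ofReal |y| ^ n * f ![s, 1] ≤ 1} =
        (y * ·) ⁻¹' ((fun x => (x, y)) ⁻¹' {q : ℝ × ℝ | f ![q.1, q.2] ≤ 1}) := by
      ext s
      have := hhom y ![s, 1]
      simp only [Matrix.smul_cons, smul_eq_mul, mul_one, Matrix.smul_empty] at this
      simp [this]
    rw [e2, Real.volume_preimage_mul_left hy, ← mul_assoc, ← ENNReal.ofReal_mul (abs_nonneg _),
      abs_inv, mul_inv_cancel₀ (abs_ne_zero.2 hy), ENNReal.ofReal_one, one_mul]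
  rw [h1, Measure.volume_eq_prod, Measure.prod_apply_symm hS]
  calc _ = ∫⁻ y : ℝ, ∫⁻ s : ℝ, {q : ℝ × ℝ | ENNReal.ofReal |q.1| ^ n * f ![q.2, 1] ≤ 1}.indicator
        (fun q => ENNReal.ofReal |q.1|) (y, s) := by
        refine lintegral_congr_ae ?_
        filter_upwards [compl_mem_ae_iff.2 (measure_singleton (0 : ℝ))] with y hy
        exact hslice y hy
    _ = ∫⁻ s : ℝ, ∫⁻ y : ℝ, {q : ℝ × ℝ | ENNReal.ofReal |q.1| ^ n * f ![q.2, 1] ≤ 1}.indicator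
        (fun q => ENNReal.ofReal |q.1|) (y, s) :=
        lintegral_lintegral_swap
          ((by fun_prop : Measurable fun q : ℝ × ℝ => ENNReal.ofReal |q.1|).indicator hT).aemeasurable
    _ = _ := by
        refine lintegral_congr fun s => ?_
        rw [← lintegral_abs_setOf_pow_mul_le_one hn, ← lintegral_indicator]
        · rfl
        · exact measurable_prodMk_right hT

/-! ### Logarithmic means on the unit circle and Jensen's inequality -/

theorem ae_mul_circleMap_add_ne_zero {A B : ℂ} (h : A ≠ 0 ∨ B ≠ 0) :
    ∀ᵐ θ : ℝ, A * circleMap 0 1 θ + B ≠ 0 := by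
  rcases eq_or_ne A 0 with rfl | hA
  · simpa using h
  have hc : (circleMap 0 1 ⁻¹' {-B / A}).Countable :=
    (Set.countable_singleton (-B / A)).preimage_circleMap 0 one_ne_zero
  filter_upwards [compl_mem_ae_iff.2 (hc.measure_zero volume)] with θ hθ h0
  refine hθ ?_
  rw [Set.mem_preimage, Set.mem_singleton_iff, eq_div_iff hA]
  linear_combination h0

theorem circleAverage_log_norm_mul_add {A B : ℂ} (hA : A ≠ 0) :
    Real.circleAverage (fun u => Real.log ‖A * u + B‖) 0 1 =
      Real.log ‖A‖ + Real.posLog ‖B / A‖ := by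
  have h1 : Real.circleAverage (fun u => Real.log ‖A * u + B‖) 0 1 =
      Real.circleAverage (fun u => Real.log ‖A‖ + Real.log ‖u + B / A‖) 0 1 := by
    rw [Real.circleAverage_def, Real.circleAverage_def]
    congr 1
    refine intervalIntegral.integral_congr_ae ?_
    filter_upwards [ae_mul_circleMap_add_ne_zero (A := A) (B := B) (.inl hA)] with θ hθ _
    have e : A * circleMap 0 1 θ + B = A * (circleMap 0 1 θ + B / A) := by field_simp
    rw [e] at hθ ⊢
    rw [norm_mul, Real.log_mul (norm_ne_zero_iff.2 hA)
      (norm_ne_zero_iff.2 (mul_ne_zero_iff.1 hθ).2)]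
  rw [h1, Real.circleAverage_fun_add (circleIntegrable_const _ 0 1)
    (MeromorphicOn.circleIntegrable_log_norm (fun _ _ ↦ by fun_prop)),
    Real.circleAverage_const, circleAverage_log_norm_add_const_eq_posLog]

/-- The sub-mean-value property of the subharmonic function `log |A u + B|` at `u = 0`. -/
theorem log_norm_le_circleAverage {A B : ℂ} (hB : B ≠ 0) :
    Real.log ‖B‖ ≤ Real.circleAverage (fun u => Real.log ‖A * u + B‖) 0 1 := by
  rcases eq_or_ne A 0 with rfl | hA
  · simp [Real.circleAverage_const]
  · rw [circleAverage_log_norm_mul_add hA]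
    have : Real.log ‖B / A‖ ≤ Real.posLog ‖B / A‖ := le_max_right _ _
    rw [norm_div, Real.log_div (norm_ne_zero_iff.2 hB) (norm_ne_zero_iff.2 hA)] at this
    rw [norm_div]
    linarith

/-- The zero of `A u + B` lies on the unit circle, hence not inside it, and the mean value property
is still exact. -/
theorem circleAverage_log_norm_of_norm_eq {A B : ℂ} (hB : B ≠ 0) (h : ‖A‖ = ‖B‖) :
    Real.circleAverage (fun u => Real.log ‖A * u + B‖) 0 1 = Real.log ‖B‖ := by
  have hA : A ≠ 0 := norm_ne_zero_iff.1 (h ▸ norm_ne_zero_iff.2 hB)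
  rw [circleAverage_log_norm_mul_add hA, norm_div, h,
    div_self (norm_ne_zero_iff.2 hB)]
  simp

theorem ofReal_integral_le_lintegral {α : Type*} [MeasurableSpace α] {μ : Measure α} {f : α → ℝ}
    (hf : Integrable f μ) : ENNReal.ofReal (∫ x, f x ∂μ) ≤ ∫⁻ x, ENNReal.ofReal (f x) ∂μ := by
  rw [integral_eq_lintegral_pos_part_sub_lintegral_neg_part hf]
  exact (ENNReal.ofReal_le_ofReal (sub_le_self _ ENNReal.toReal_nonneg)).trans
    ENNReal.ofReal_toReal_le

/-- Jensen for `exp`, from the tangent line at the mean `c`: `exp X ≥ exp c * (1 - c + X)`. With the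
right side in `ENNReal`, integrability of `exp X` is not needed. -/
theorem ofReal_exp_circleAverage_le {X : ℂ → ℝ} (hX : CircleIntegrable X 0 1) :
    ENNReal.ofReal (Real.exp (Real.circleAverage X 0 1)) ≤ (ENNReal.ofReal (2 * Real.pi))⁻¹ *
      ∫⁻ θ in Set.Ioc 0 (2 * Real.pi), ENNReal.ofReal (Real.exp (X (circleMap 0 1 θ))) := by
  have hpi : 0 < 2 * Real.pi := by positivity
  set c := Real.circleAverage X 0 1 with hc
  have hXi : IntegrableOn (fun θ => X (circleMap 0 1 θ)) (Set.Ioc 0 (2 * Real.pi)) :=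
    (intervalIntegrable_iff_integrableOn_Ioc_of_le hpi.le).1 hX
  have hcint : ∫ θ in Set.Ioc 0 (2 * Real.pi), X (circleMap 0 1 θ) = 2 * Real.pi * c := by
    rw [hc, Real.circleAverage_def, intervalIntegral.integral_of_le hpi.le, smul_eq_mul,
      mul_inv_cancel_left₀ hpi.ne']
  have hconst : IntegrableOn (fun _ : ℝ => (1 - c : ℝ)) (Set.Ioc 0 (2 * Real.pi)) :=
    integrableOn_const measure_Ioc_lt_top.ne
  have hsum : IntegrableOn (fun θ => Real.exp c * ((1 - c) + X (circleMap 0 1 θ)))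
      (Set.Ioc 0 (2 * Real.pi)) := (hconst.add hXi).const_mul _
  have hval : ∫ θ in Set.Ioc 0 (2 * Real.pi), Real.exp c * ((1 - c) + X (circleMap 0 1 θ)) =
      2 * Real.pi * Real.exp c := by
    rw [integral_const_mul, integral_add hconst hXi, hcint]
    simp [hpi.le]
    ring
  have hle : ENNReal.ofReal (2 * Real.pi * Real.exp c) ≤
      ∫⁻ θ in Set.Ioc 0 (2 * Real.pi), ENNReal.ofReal (Real.exp (X (circleMap 0 1 θ))) := by
    rw [← hval]
    refine (ofReal_integral_le_lintegral hsum).trans (lintegral_mono fun θ =>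
      ENNReal.ofReal_le_ofReal ?_)
    have h1 := Real.add_one_le_exp (X (circleMap 0 1 θ) - c)
    calc Real.exp c * ((1 - c) + X (circleMap 0 1 θ))
        ≤ Real.exp c * Real.exp (X (circleMap 0 1 θ) - c) :=
          mul_le_mul_of_nonneg_left (by linarith) (Real.exp_pos c).le
      _ = Real.exp (X (circleMap 0 1 θ)) := by rw [← Real.exp_add]; congr 1; ring
  rw [ENNReal.ofReal_mul hpi.le, mul_comm] at hle
  rw [mul_comm, ← div_eq_mul_inv, ENNReal.le_div_iff_mul_le (.inl (by simpa using Real.pi_pos))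
    (.inl ENNReal.ofReal_ne_top)]
  exact hle

theorem enorm_rpow_eq_ofReal_exp {z : ℂ} (hz : z ≠ 0) (r : ℝ) :
    ‖z‖ₑ ^ r = ENNReal.ofReal (Real.exp (r * Real.log ‖z‖)) := by
  have h : 0 < ‖z‖ := norm_pos_iff.2 hz
  rw [← ofReal_norm, ENNReal.ofReal_rpow_of_pos h, Real.rpow_def_of_pos h, mul_comm]

/-- The positive exponents only need the sub-mean-value inequality. The negative exponent would
reverse it, so equality is required there, and `‖A₃‖ = ‖B₃‖` supplies it. -/
theorem enorm_rpow_mul_le_circle_lintegral {A₁ B₁ A₂ B₂ A₃ B₃ : ℂ} (h₁ : B₁ ≠ 0) (h₂ : B₂ ≠ 0)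
    (h₃ : B₃ ≠ 0) (h : ‖A₃‖ = ‖B₃‖) :
    ‖B₁‖ₑ ^ (1 / 3 : ℝ) * ‖B₂‖ₑ ^ (1 / 3 : ℝ) * ‖B₃‖ₑ ^ (-(2 / 3) : ℝ) ≤
      (ENNReal.ofReal (2 * Real.pi))⁻¹ * ∫⁻ θ in Set.Ioc 0 (2 * Real.pi),
        ‖A₁ * circleMap 0 1 θ + B₁‖ₑ ^ (1 / 3 : ℝ) * ‖A₂ * circleMap 0 1 θ + B₂‖ₑ ^ (1 / 3 : ℝ) *
          ‖A₃ * circleMap 0 1 θ + B₃‖ₑ ^ (-(2 / 3) : ℝ) := by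
  have hint : ∀ (c : ℝ) (A B : ℂ), CircleIntegrable (fun u => c * Real.log ‖A * u + B‖) 0 1 :=
    fun c A B => (MeromorphicOn.circleIntegrable_log_norm
      (f := fun u => A * u + B) (fun _ _ ↦ by fun_prop)).const_mul c
  set X : ℂ → ℝ := fun u => (1 / 3 : ℝ) * Real.log ‖A₁ * u + B₁‖ +
    (1 / 3 : ℝ) * Real.log ‖A₂ * u + B₂‖ + (-(2 / 3) : ℝ) * Real.log ‖A₃ * u + B₃‖ with hXdef
  have hX : CircleIntegrable X 0 1 := ((hint _ _ _).add (hint _ _ _)).add (hint _ _ _)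
  have hav : Real.circleAverage X 0 1 =
      (1 / 3 : ℝ) * Real.circleAverage (fun u => Real.log ‖A₁ * u + B₁‖) 0 1 +
      (1 / 3 : ℝ) * Real.circleAverage (fun u => Real.log ‖A₂ * u + B₂‖) 0 1 +
      (-(2 / 3) : ℝ) * Real.circleAverage (fun u => Real.log ‖A₃ * u + B₃‖) 0 1 := by
    have h12 : CircleIntegrable (fun u => (1 / 3 : ℝ) * Real.log ‖A₁ * u + B₁‖ +
        (1 / 3 : ℝ) * Real.log ‖A₂ * u + B₂‖) 0 1 := (hint _ _ _).add (hint _ _ _)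
    rw [hXdef, Real.circleAverage_fun_add h12 (hint _ _ _),
      Real.circleAverage_fun_add (hint _ _ _) (hint _ _ _)]
    simp only [← smul_eq_mul, Real.circleAverage_fun_smul]
  have hle : (1 / 3 : ℝ) * Real.log ‖B₁‖ + (1 / 3 : ℝ) * Real.log ‖B₂‖ +
      (-(2 / 3) : ℝ) * Real.log ‖B₃‖ ≤ Real.circleAverage X 0 1 := by
    rw [hav, circleAverage_log_norm_of_norm_eq h₃ h]
    have := log_norm_le_circleAverage (A := A₁) h₁
    have := log_norm_le_circleAverage (A := A₂) h₂
    linarith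
  rw [enorm_rpow_eq_ofReal_exp h₁, enorm_rpow_eq_ofReal_exp h₂, enorm_rpow_eq_ofReal_exp h₃,
    ← ENNReal.ofReal_mul (Real.exp_pos _).le, ← Real.exp_add,
    ← ENNReal.ofReal_mul (Real.exp_pos _).le, ← Real.exp_add]
  refine (ENNReal.ofReal_le_ofReal (Real.exp_le_exp.2 hle)).trans
    ((ofReal_exp_circleAverage_le hX).trans (le_of_eq ?_))
  congr 1
  refine lintegral_congr_ae (ae_restrict_of_ae ?_)
  filter_upwards [ae_mul_circleMap_add_ne_zero (A := A₁) (.inr h₁),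
    ae_mul_circleMap_add_ne_zero (A := A₂) (.inr h₂),
    ae_mul_circleMap_add_ne_zero (A := A₃) (.inr h₃)] with θ g₁ g₂ g₃
  rw [enorm_rpow_eq_ofReal_exp g₁, enorm_rpow_eq_ofReal_exp g₂, enorm_rpow_eq_ofReal_exp g₃,
    ← ENNReal.ofReal_mul (Real.exp_pos _).le, ← Real.exp_add,
    ← ENNReal.ofReal_mul (Real.exp_pos _).le, ← Real.exp_add]

/-! ### Reduction from complex to real triples of linear forms -/

/-- The determinant of two pairs; the linear form `α X - β Y` takes the value
`wedge (α, β) (y, x)` at `(x, y)`. -/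
def wedge (p q : ℂ × ℂ) : ℂ := p.1 * q.2 - p.2 * q.1

@[fun_prop]
theorem measurable_wedge {α : Type*} [MeasurableSpace α] {f g : α → ℂ × ℂ} (hf : Measurable f)
    (hg : Measurable g) : Measurable fun x => wedge (f x) (g x) := by
  unfold wedge
  fun_prop

theorem enorm_wedge_comm (p q : ℂ × ℂ) : ‖wedge p q‖ₑ = ‖wedge q p‖ₑ := by
  rw [← enorm_neg]
  congr 1
  simp only [wedge]
  ring

theorem wedge_smul_left (c : ℂ) (p q : ℂ × ℂ) : wedge (c • p) q = c * wedge p q := by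
  simp [wedge]
  ring

/-- The integral of `|l₁ l₂ l₃| ^ (-2/3)` over a line, for three complex linear forms, normalized
by their discriminant. -/
noncomputable def tripleIntegral (p q r : ℂ × ℂ) : ENNReal :=
  ∫⁻ s : ℝ, ‖wedge p q‖ₑ ^ (1 / 3 : ℝ) * ‖wedge p r‖ₑ ^ (1 / 3 : ℝ) *
      ‖wedge p (1, (s : ℂ))‖ₑ ^ (-(2 / 3) : ℝ) *
    (‖wedge q r‖ₑ ^ (1 / 3 : ℝ) * ‖wedge q (1, (s : ℂ))‖ₑ ^ (-(2 / 3) : ℝ) *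
      ‖wedge r (1, (s : ℂ))‖ₑ ^ (-(2 / 3) : ℝ))

theorem tripleIntegral_swap_left (p q r : ℂ × ℂ) :
    tripleIntegral p q r = tripleIntegral q p r := by
  refine lintegral_congr fun s => ?_
  rw [enorm_wedge_comm p q]
  ring

theorem tripleIntegral_swap_right (p q r : ℂ × ℂ) :
    tripleIntegral p q r = tripleIntegral p r q := by
  refine lintegral_congr fun s => ?_
  rw [enorm_wedge_comm q r]
  ring

/-- The exponents `1/3 + 1/3 - 2/3` cancel. This permits discarding the complex scalar that
separates `u l̄ + l` from a real form. -/
theorem tripleIntegral_smul {c : ℂ} (hc : c ≠ 0) (p q r : ℂ × ℂ) :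
    tripleIntegral (c • p) q r = tripleIntegral p q r := by
  refine lintegral_congr fun s => ?_
  have h0 : ‖c‖ₑ ≠ 0 := enorm_ne_zero.2 hc
  have h1 : ‖c‖ₑ ^ (1 / 3 : ℝ) * ‖c‖ₑ ^ (1 / 3 : ℝ) * ‖c‖ₑ ^ (-(2 / 3) : ℝ) = 1 := by
    rw [← ENNReal.rpow_add _ _ h0 enorm_ne_top, ← ENNReal.rpow_add _ _ h0 enorm_ne_top]
    norm_num
  simp only [wedge_smul_left, enorm_mul,
    ENNReal.mul_rpow_of_ne_top enorm_ne_top enorm_ne_top]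
  congr 1
  calc _ = (‖c‖ₑ ^ (1 / 3 : ℝ) * ‖c‖ₑ ^ (1 / 3 : ℝ) * ‖c‖ₑ ^ (-(2 / 3) : ℝ)) *
        (‖wedge p q‖ₑ ^ (1 / 3 : ℝ) * ‖wedge p r‖ₑ ^ (1 / 3 : ℝ) *
        ‖wedge p (1, (s : ℂ))‖ₑ ^ (-(2 / 3) : ℝ)) := by ring
    _ = _ := by rw [h1, one_mul]

theorem tripleIntegral_eq_zero_of_wedge_left {p q : ℂ × ℂ} (h : wedge p q = 0) (r : ℂ × ℂ) :
    tripleIntegral p q r = 0 := by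
  simp [tripleIntegral, h]

theorem ae_wedge_ne_zero {p : ℂ × ℂ} (hp : p ≠ 0) : ∀ᵐ s : ℝ, wedge p (1, (s : ℂ)) ≠ 0 := by
  have hsub : {s : ℝ | wedge p (1, (s : ℂ)) = 0}.Subsingleton := by
    intro s hs t ht
    simp only [wedge, Set.mem_ofPred_eq, mul_one] at hs ht
    by_contra hst
    have hst' : (s : ℂ) - t ≠ 0 := sub_ne_zero.2 (by exact_mod_cast hst)
    have h1 : p.1 = 0 := by
      refine (mul_eq_zero.1 (?_ : p.1 * ((s : ℂ) - t) = 0)).resolve_right hst'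
      linear_combination hs - ht
    refine hp (Prod.ext h1 ?_)
    simpa [h1] using hs
  filter_upwards [compl_mem_ae_iff.2 (hsub.countable.measure_zero volume)] with s hs
  exact hs

/-- The form `u l̄ + l`; for `u` on the unit circle it is proportional to a real form. -/
def conjCombination (p : ℂ × ℂ) (u : ℂ) : ℂ × ℂ := u • star p + p

theorem wedge_conjCombination (p : ℂ × ℂ) (u : ℂ) (q : ℂ × ℂ) :
    wedge (conjCombination p u) q = wedge (star p) q * u + wedge p q := by
  simp [wedge, conjCombination]
  ring

theorem norm_wedge_star_real (p : ℂ × ℂ) (s : ℝ) :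
    ‖wedge (star p) (1, (s : ℂ))‖ = ‖wedge p (1, (s : ℂ))‖ := by
  rw [← norm_star]
  congr 1
  simp [wedge]

/-- Pointwise in `s`, the three factors containing `p` become affine functions of `u`, whose values
at `u = 0` are the original ones. The factor with negative exponent has coefficients of equal
modulus because `s` is real. -/
theorem tripleIntegral_le_circle_lintegral (p q r : ℂ × ℂ) :
    tripleIntegral p q r ≤ (ENNReal.ofReal (2 * Real.pi))⁻¹ *
      ∫⁻ θ in Set.Ioc 0 (2 * Real.pi),
        tripleIntegral (conjCombination p (circleMap 0 1 θ)) q r := by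
  by_cases hpq : wedge p q = 0
  · simp [tripleIntegral_eq_zero_of_wedge_left hpq]
  by_cases hpr : wedge p r = 0
  · simp [tripleIntegral_swap_right p q, tripleIntegral_eq_zero_of_wedge_left hpr]
  have hp : p ≠ 0 := by
    rintro rfl
    simp [wedge] at hpq
  have hm : Measurable fun z : ℝ × ℝ =>
      ‖wedge (conjCombination p (circleMap 0 1 z.1)) q‖ₑ ^ (1 / 3 : ℝ) *
      ‖wedge (conjCombination p (circleMap 0 1 z.1)) r‖ₑ ^ (1 / 3 : ℝ) *
      ‖wedge (conjCombination p (circleMap 0 1 z.1)) (1, (z.2 : ℂ))‖ₑ ^ (-(2 / 3) : ℝ) *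
      (‖wedge q r‖ₑ ^ (1 / 3 : ℝ) * ‖wedge q (1, (z.2 : ℂ))‖ₑ ^ (-(2 / 3) : ℝ) *
      ‖wedge r (1, (z.2 : ℂ))‖ₑ ^ (-(2 / 3) : ℝ)) := by
    have : Measurable fun z : ℝ × ℝ => conjCombination p (circleMap 0 1 z.1) := by
      unfold conjCombination circleMap
      fun_prop
    fun_prop
  unfold tripleIntegral
  rw [lintegral_lintegral_swap hm.aemeasurable, ← lintegral_const_mul' _ _ (by
    simpa using Real.pi_pos)]
  refine lintegral_mono_ae ?_
  filter_upwards [ae_wedge_ne_zero hp] with s hs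
  rw [lintegral_mul_const _ (by
    unfold conjCombination circleMap
    fun_prop)]
  simp only [wedge_conjCombination]
  exact (mul_le_mul' (enorm_rpow_mul_le_circle_lintegral hpq hpr hs (norm_wedge_star_real p s))
    le_rfl).trans_eq (mul_assoc _ _ _)

theorem tripleIntegral_le_of_forall_circle {K : ENNReal} {p q r : ℂ × ℂ}
    (h : ∀ θ : ℝ, tripleIntegral (conjCombination p (circleMap 0 1 θ)) q r ≤ K) :
    tripleIntegral p q r ≤ K := by
  refine (tripleIntegral_le_circle_lintegral p q r).trans ?_
  have hpi : ENNReal.ofReal (2 * Real.pi) ≠ 0 := by simpa using Real.pi_pos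
  calc _ ≤ (ENNReal.ofReal (2 * Real.pi))⁻¹ * ∫⁻ θ in Set.Ioc 0 (2 * Real.pi), K := by
        gcongr with θ
        exact h θ
    _ = K := by
        rw [setLIntegral_const, Real.volume_Ioc, sub_zero, mul_comm K, ← mul_assoc,
          ENNReal.inv_mul_cancel hpi ENNReal.ofReal_ne_top, one_mul]

/-- A pair of reals, seen as a pair of complex numbers. -/
def realPair (a : ℝ × ℝ) : ℂ × ℂ := ((a.1 : ℂ), (a.2 : ℂ))

/-- For `u = e^(iθ)`, `u z̄ + z = e^(iθ/2) · 2 Re(e^(-iθ/2) z)`, with the same factor `e^(iθ/2)` for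
both coordinates. -/
theorem exists_conjCombination_eq_smul_realPair (p : ℂ × ℂ) (θ : ℝ) :
    ∃ (c : ℂ) (a : ℝ × ℝ), c ≠ 0 ∧ conjCombination p (circleMap 0 1 θ) = c • realPair a := by
  have key : ∀ z : ℂ, circleMap 0 1 θ * star z + z = Complex.exp (θ / 2 * Complex.I) *
      ((2 * (Complex.exp (-(θ / 2) * Complex.I) * z).re : ℝ) : ℂ) := by
    intro z
    rw [← Complex.add_conj, map_mul, ← Complex.exp_conj, mul_add, ← mul_assoc, ← mul_assoc,
      ← Complex.exp_add, ← Complex.exp_add]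
    simp only [map_mul, map_neg, map_div₀, Complex.conj_ofReal, Complex.conj_I, map_ofNat,
      circleMap]
    ring_nf
    simp
  refine ⟨Complex.exp (θ / 2 * Complex.I),
    (2 * (Complex.exp (-(θ / 2) * Complex.I) * p.1).re,
      2 * (Complex.exp (-(θ / 2) * Complex.I) * p.2).re), Complex.exp_ne_zero _, ?_⟩
  ext1
  · exact key p.1
  · exact key p.2

theorem tripleIntegral_le_of_realPair {K : ENNReal}
    (h : ∀ a b c, tripleIntegral (realPair a) (realPair b) (realPair c) ≤ K) (p q r : ℂ × ℂ) :
    tripleIntegral p q r ≤ K := by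
  have step : ∀ {q r : ℂ × ℂ}, (∀ a, tripleIntegral (realPair a) q r ≤ K) →
      ∀ p, tripleIntegral p q r ≤ K := by
    intro q r hqr p
    refine tripleIntegral_le_of_forall_circle fun θ => ?_
    obtain ⟨c, a, hc, he⟩ := exists_conjCombination_eq_smul_realPair p θ
    rw [he, tripleIntegral_smul hc]
    exact hqr a
  refine step (fun a => ?_) p
  rw [tripleIntegral_swap_left]
  refine step (fun b => ?_) q
  rw [tripleIntegral_swap_right, tripleIntegral_swap_left]
  refine step (fun c => ?_) r
  rw [tripleIntegral_swap_right]
  exact h c a b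

/-! ### Real triples and the region of `XY(X-Y)` -/

theorem volume_prod_enorm_wedge_le_one {n : ℕ} (hn : 0 < n) (p : Fin n → ℂ × ℂ) :
    volume {v : Fin 2 → ℝ | ∏ i, ‖wedge (p i) ((v 1 : ℂ), (v 0 : ℂ))‖ₑ ≤ 1} =
      ∫⁻ s : ℝ, ∏ i, ‖wedge (p i) (1, (s : ℂ))‖ₑ ^ (-(2 / n : ℝ)) := by
  rw [volume_homogeneous_le_one hn
    (f := fun v : Fin 2 → ℝ => ∏ i, ‖wedge (p i) ((v 1 : ℂ), (v 0 : ℂ))‖ₑ) (by fun_prop)]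
  · refine lintegral_congr fun s => ?_
    rw [← ENNReal.prod_rpow_of_ne_top fun i _ => enorm_ne_top]
    simp
  · intro c v
    have h : ∀ i, ‖wedge (p i) (((c • v) 1 : ℝ), ((c • v) 0 : ℝ))‖ₑ =
        ENNReal.ofReal |c| * ‖wedge (p i) ((v 1 : ℂ), (v 0 : ℂ))‖ₑ := by
      intro i
      have : wedge (p i) (((c • v) 1 : ℝ), ((c • v) 0 : ℝ)) =
          (c : ℂ) * wedge (p i) ((v 1 : ℂ), (v 0 : ℂ)) := by
        simp [wedge]
        ring
      rw [this, enorm_mul, ← ofReal_norm (c : ℂ), Complex.norm_real, Real.norm_eq_abs]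
    simp_rw [h]
    rw [Finset.prod_mul_distrib]
    simp

theorem tripleIntegral_eq_mul_volume (p : Fin 3 → ℂ × ℂ) :
    tripleIntegral (p 0) (p 1) (p 2) =
      (‖wedge (p 0) (p 1)‖ₑ * ‖wedge (p 0) (p 2)‖ₑ * ‖wedge (p 1) (p 2)‖ₑ) ^ (1 / 3 : ℝ) *
      volume {v : Fin 2 → ℝ | ∏ i, ‖wedge (p i) ((v 1 : ℂ), (v 0 : ℂ))‖ₑ ≤ 1} := by
  rw [volume_prod_enorm_wedge_le_one (by norm_num), ← lintegral_const_mul _ (by fun_prop),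
    tripleIntegral]
  refine lintegral_congr fun s => ?_
  rw [ENNReal.mul_rpow_of_nonneg _ _ (by norm_num), ENNReal.mul_rpow_of_nonneg _ _ (by norm_num),
    Fin.prod_univ_three]
  push_cast
  ring

/-- The region `|XY(X - Y)| ≤ 1`. -/
def triangleRegion : Set (Fin 2 → ℝ) := {v | |v 0 * v 1 * (v 0 - v 1)| ≤ 1}

theorem enorm_wedge_realPair (a b : ℝ × ℝ) :
    ‖wedge (realPair a) (realPair b)‖ₑ = ENNReal.ofReal |a.1 * b.2 - a.2 * b.1| := by
  rw [← ofReal_norm, wedge, realPair, realPair, ← Real.norm_eq_abs, ← Complex.norm_real]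
  push_cast
  rfl

/-- Three linear forms in the plane satisfy `d₂ l₀ + d₃ l₁ + d₁ l₂ = 0`. Hence the coordinates `k d₂
l₀` and `-k d₃ l₁` have difference `-k d₁ l₂`, and `XY(X-Y)` evaluated there is `k³ δ l₀ l₁ l₂`. -/
theorem volume_realPair_cubic (a : Fin 3 → ℝ × ℝ)
    (h : ((a 0).1 * (a 1).2 - (a 0).2 * (a 1).1) * ((a 1).1 * (a 2).2 - (a 1).2 * (a 2).1) *
      ((a 2).1 * (a 0).2 - (a 2).2 * (a 0).1) ≠ 0) :
    (‖wedge (realPair (a 0)) (realPair (a 1))‖ₑ * ‖wedge (realPair (a 0)) (realPair (a 2))‖ₑ *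
        ‖wedge (realPair (a 1)) (realPair (a 2))‖ₑ) ^ (1 / 3 : ℝ) *
      volume {v : Fin 2 → ℝ | ∏ i, ‖wedge (realPair (a i)) ((v 1 : ℂ), (v 0 : ℂ))‖ₑ ≤ 1} =
      volume triangleRegion := by
  set d₁ := (a 0).1 * (a 1).2 - (a 0).2 * (a 1).1 with hd₁
  set d₂ := (a 1).1 * (a 2).2 - (a 1).2 * (a 2).1 with hd₂
  set d₃ := (a 2).1 * (a 0).2 - (a 2).2 * (a 0).1 with hd₃
  set δ := d₁ * d₂ * d₃ with hδ
  have hδ0 : 0 < |δ| := abs_pos.2 h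
  -- Chosen so that `k³ |δ| = 1`; the Jacobian `k² |δ| = k⁻¹` then cancels the normalizing factor.
  set k : ℝ := |δ| ^ (-(1 / 3) : ℝ) with hk
  have hk0 : 0 < k := Real.rpow_pos_of_pos hδ0 _
  have hk3 : k ^ 3 * |δ| = 1 := by
    rw [hk, ← Real.rpow_natCast, ← Real.rpow_mul hδ0.le]
    norm_num
    rw [Real.rpow_neg_one, inv_mul_cancel₀ hδ0.ne']
  have hk1 : |δ| ^ (1 / 3 : ℝ) = k⁻¹ := by rw [hk, Real.rpow_neg hδ0.le, inv_inv]
  set M : Matrix (Fin 2) (Fin 2) ℝ :=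
    !![k * d₂ * (a 0).1, -(k * d₂ * (a 0).2); -(k * d₃ * (a 1).1), k * d₃ * (a 1).2] with hM
  have hdet : LinearMap.det (Matrix.toLin' M) = k ^ 2 * δ := by
    rw [LinearMap.det_toLin', hM, Matrix.det_fin_two_of, hδ, hd₁]
    ring
  have hdet0 : LinearMap.det (Matrix.toLin' M) ≠ 0 := by
    rw [hdet]
    exact mul_ne_zero (pow_ne_zero 2 hk0.ne') h
  have hset : {v : Fin 2 → ℝ | ∏ i, ‖wedge (realPair (a i)) ((v 1 : ℂ), (v 0 : ℂ))‖ₑ ≤ 1} =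
      Matrix.toLin' M ⁻¹' triangleRegion := by
    ext v
    have e : ∀ i, ‖wedge (realPair (a i)) ((v 1 : ℂ), (v 0 : ℂ))‖ₑ =
        ENNReal.ofReal |(a i).1 * v 0 - (a i).2 * v 1| :=
      fun i => enorm_wedge_realPair (a i) (v 1, v 0)
    have e0 : (Matrix.toLin' M v) 0 = k * d₂ * ((a 0).1 * v 0 - (a 0).2 * v 1) := by
      simp [Matrix.mulVec, dotProduct, hM, Fin.sum_univ_two]
      ring
    have e1 : (Matrix.toLin' M v) 1 = -(k * d₃ * ((a 1).1 * v 0 - (a 1).2 * v 1)) := by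
      simp [Matrix.mulVec, dotProduct, hM, Fin.sum_univ_two]
      ring
    have e2 : (Matrix.toLin' M v) 0 * (Matrix.toLin' M v) 1 *
        ((Matrix.toLin' M v) 0 - (Matrix.toLin' M v) 1) = k ^ 3 * δ *
        (((a 0).1 * v 0 - (a 0).2 * v 1) * ((a 1).1 * v 0 - (a 1).2 * v 1) *
          ((a 2).1 * v 0 - (a 2).2 * v 1)) := by
      have e3 : (Matrix.toLin' M v) 0 - (Matrix.toLin' M v) 1 =
          -(k * d₁ * ((a 2).1 * v 0 - (a 2).2 * v 1)) := by
        rw [e0, e1, hd₁, hd₂, hd₃]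
        ring
      rw [e3, e0, e1, hδ]
      ring
    rw [Set.mem_preimage, triangleRegion, Set.mem_ofPred_eq, Set.mem_ofPred_eq, e2, abs_mul,
      abs_mul, abs_pow, abs_of_pos hk0, hk3, one_mul]
    simp_rw [e]
    rw [← ENNReal.ofReal_prod_of_nonneg (fun i _ => abs_nonneg _), ENNReal.ofReal_le_one,
      Fin.prod_univ_three, abs_mul, abs_mul]
  have hw : ‖wedge (realPair (a 0)) (realPair (a 1))‖ₑ *
      ‖wedge (realPair (a 0)) (realPair (a 2))‖ₑ *
      ‖wedge (realPair (a 1)) (realPair (a 2))‖ₑ = ENNReal.ofReal |δ| := by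
    rw [enorm_wedge_comm (realPair (a 0)) (realPair (a 2))]
    simp only [enorm_wedge_realPair]
    rw [← ENNReal.ofReal_mul (abs_nonneg _), ← ENNReal.ofReal_mul (by positivity), hδ, abs_mul,
      abs_mul]
    congr 1
    ring
  rw [hw, hset, Measure.addHaar_preimage_linearMap volume hdet0, hdet,
    ENNReal.ofReal_rpow_of_pos hδ0, hk1, ← mul_assoc, ← ENNReal.ofReal_mul (by positivity)]
  have : k⁻¹ * |(k ^ 2 * δ)⁻¹| = 1 := by
    rw [abs_inv, abs_mul, abs_of_pos (pow_pos hk0 2), ← mul_inv, ← mul_assoc, ← pow_succ', hk3,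
      inv_one]
  rw [this, ENNReal.ofReal_one, one_mul]

theorem tripleIntegral_le_volume_triangleRegion (p q r : ℂ × ℂ) :
    tripleIntegral p q r ≤ volume triangleRegion := by
  refine tripleIntegral_le_of_realPair (fun a b c => ?_) p q r
  have h := tripleIntegral_eq_mul_volume ![realPair a, realPair b, realPair c]
  by_cases hδ : (a.1 * b.2 - a.2 * b.1) * (b.1 * c.2 - b.2 * c.1) * (c.1 * a.2 - c.2 * a.1) = 0
  · have hw : ‖wedge (realPair a) (realPair b)‖ₑ * ‖wedge (realPair a) (realPair c)‖ₑ *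
        ‖wedge (realPair b) (realPair c)‖ₑ = 0 := by
      rw [enorm_wedge_comm (realPair a) (realPair c)]
      simp only [enorm_wedge_realPair]
      rcases mul_eq_zero.1 hδ with h | h
      · rcases mul_eq_zero.1 h with h | h <;> simp [h]
      · simp [h]
    simp only [Matrix.cons_val] at h
    rw [h, hw]
    simp
  · have h' := volume_realPair_cubic ![a, b, c] hδ
    have hp : ![realPair a, realPair b, realPair c] = fun i => realPair (![a, b, c] i) := by
      ext i : 1
      fin_cases i <;> rfl
    rw [hp] at h
    exact (h.trans h').le

/-! ### The area of `|XY(X-Y)| ≤ 1` as three Beta integrals -/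

theorem enorm_rpow_eq_ofReal {x : ℝ} (hx : 0 < x) (r : ℝ) : ‖x‖ₑ ^ r = ENNReal.ofReal (x ^ r) := by
  rw [Real.enorm_eq_ofReal hx.le, ENNReal.ofReal_rpow_of_pos hx]

theorem lintegral_Ioo_beta_third :
    ∫⁻ s in Set.Ioo (0 : ℝ) 1, ‖s * (s - 1)‖ₑ ^ (-(2 / 3) : ℝ) =
      ENNReal.ofReal (ProbabilityTheory.beta (1 / 3) (1 / 3)) := by
  have hB : 0 < ProbabilityTheory.beta (1 / 3) (1 / 3) :=
    ProbabilityTheory.beta_pos (by norm_num) (by norm_num)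
  have h := ProbabilityTheory.lintegral_betaPDF_eq_one (α := 1 / 3) (β := 1 / 3)
    (by norm_num) (by norm_num)
  rw [ProbabilityTheory.lintegral_betaPDF] at h
  have e : ∫⁻ x in Set.Ioo (0 : ℝ) 1, ENNReal.ofReal (1 / ProbabilityTheory.beta (1 / 3) (1 / 3) *
      x ^ ((1 / 3 : ℝ) - 1) * (1 - x) ^ ((1 / 3 : ℝ) - 1)) =
      ENNReal.ofReal (1 / ProbabilityTheory.beta (1 / 3) (1 / 3)) *
        ∫⁻ s in Set.Ioo (0 : ℝ) 1, ‖s * (s - 1)‖ₑ ^ (-(2 / 3) : ℝ) := by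
    rw [← lintegral_const_mul _ (by fun_prop)]
    refine setLIntegral_congr_fun measurableSet_Ioo fun x hx => ?_
    have h1 : 0 < 1 - x := by linarith [hx.2]
    have : ‖x * (x - 1)‖ₑ = ‖x * (1 - x)‖ₑ := by
      rw [← enorm_neg]
      congr 1
      ring
    simp only [this]
    rw [enorm_rpow_eq_ofReal (mul_pos hx.1 h1), ← ENNReal.ofReal_mul (by positivity),
      Real.mul_rpow hx.1.le h1.le, mul_assoc]
    norm_num
  rw [e, one_div, ENNReal.ofReal_inv_of_pos hB] at h
  have h2 : ENNReal.ofReal (ProbabilityTheory.beta (1 / 3) (1 / 3)) ≠ 0 := by simpa using hB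
  exact (ENNReal.eq_inv_of_mul_eq_one_left (by rwa [mul_comm] at h)).trans (inv_inv _)

/-- Under `s = 1/x` one has `s(s-1) = (1-x)/x²`, and the Jacobian `x⁻²` times `x^(4/3)` restores
`x^(-2/3)`. -/
theorem lintegral_Ioi_one_eq_Ioo :
    ∫⁻ s in Set.Ioi (1 : ℝ), ‖s * (s - 1)‖ₑ ^ (-(2 / 3) : ℝ) =
      ∫⁻ s in Set.Ioo (0 : ℝ) 1, ‖s * (s - 1)‖ₑ ^ (-(2 / 3) : ℝ) := by
  have himg : (fun x : ℝ => x⁻¹) '' Set.Ioo 0 1 = Set.Ioi 1 := by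
    ext y
    constructor
    · rintro ⟨x, hx, rfl⟩
      exact (one_lt_inv₀ hx.1).2 hx.2
    · intro hy
      exact ⟨y⁻¹, ⟨inv_pos.2 (zero_lt_one.trans hy), inv_lt_one_of_one_lt₀ hy⟩, inv_inv y⟩
  rw [← himg, lintegral_image_eq_lintegral_abs_deriv_mul measurableSet_Ioo
    (fun x hx => (hasDerivAt_inv hx.1.ne').hasDerivWithinAt) inv_injective.injOn]
  refine setLIntegral_congr_fun measurableSet_Ioo fun x hx => ?_
  have hx0 := hx.1
  have h1 : 0 < 1 - x := by linarith [hx.2]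
  have e1 : ‖x * (x - 1)‖ₑ = ‖x * (1 - x)‖ₑ := by
    rw [← enorm_neg]
    congr 1
    ring
  have e2 : x⁻¹ * (x⁻¹ - 1) = (1 - x) * (x ^ 2)⁻¹ := by field_simp
  simp only [e1, e2]
  rw [enorm_rpow_eq_ofReal (by positivity), enorm_rpow_eq_ofReal (by positivity),
    ← ENNReal.ofReal_mul (abs_nonneg _), abs_neg, abs_of_pos (by positivity),
    Real.mul_rpow h1.le (by positivity), Real.mul_rpow hx0.le h1.le, mul_left_comm, mul_comm]
  congr 2
  rw [← Real.rpow_natCast, ← Real.rpow_neg hx0.le, ← Real.rpow_mul hx0.le, ← Real.rpow_add hx0]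
  norm_num

theorem lintegral_Iio_zero_eq_Ioi :
    ∫⁻ s in Set.Iio (0 : ℝ), ‖s * (s - 1)‖ₑ ^ (-(2 / 3) : ℝ) =
      ∫⁻ s in Set.Ioi (1 : ℝ), ‖s * (s - 1)‖ₑ ^ (-(2 / 3) : ℝ) := by
  have himg : (fun x : ℝ => 1 - x) '' Set.Ioi 1 = Set.Iio 0 := by
    simp
  have hd : ∀ x, HasDerivWithinAt (fun x : ℝ => 1 - x) (-1) (Set.Ioi 1) x :=
    fun x => ((hasDerivAt_id x).const_sub 1).hasDerivWithinAt
  rw [← himg, lintegral_image_eq_lintegral_abs_deriv_mul measurableSet_Ioi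
    (fun x _ => hd x) (sub_right_injective.injOn)]
  refine setLIntegral_congr_fun measurableSet_Ioi fun x _ => ?_
  have e : (1 - x) * (1 - x - 1) = x * (x - 1) := by ring
  simp only [e]
  simp

theorem volume_triangleRegion :
    volume triangleRegion = ENNReal.ofReal (3 * ProbabilityTheory.beta (1 / 3) (1 / 3)) := by
  have h1 : triangleRegion = {v : Fin 2 → ℝ | ‖v 0 * v 1 * (v 0 - v 1)‖ₑ ≤ 1} := by
    ext v
    rw [triangleRegion, Set.mem_ofPred_eq, Set.mem_ofPred_eq, Real.enorm_eq_ofReal_abs,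
      ENNReal.ofReal_le_one]
  rw [h1, volume_homogeneous_le_one (n := 3) (by norm_num)
    (f := fun v : Fin 2 → ℝ => ‖v 0 * v 1 * (v 0 - v 1)‖ₑ) (by fun_prop)]
  · have e : ∀ s : ℝ, ‖(![s, 1] : Fin 2 → ℝ) 0 * (![s, 1] : Fin 2 → ℝ) 1 *
        ((![s, 1] : Fin 2 → ℝ) 0 - (![s, 1] : Fin 2 → ℝ) 1)‖ₑ ^ (-(2 / (3 : ℕ)) : ℝ) =
        ‖s * (s - 1)‖ₑ ^ (-(2 / 3) : ℝ) := by
      intro s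
      simp
    simp_rw [e]
    rw [← lintegral_add_compl _ (measurableSet_Iic (a := (0 : ℝ))), setLIntegral_congr
      Iio_ae_eq_Iic.symm, Set.compl_Iic, ← Set.Ioc_union_Ioi_eq_Ioi zero_le_one,
      lintegral_union measurableSet_Ioi (Set.Ioc_disjoint_Ioi le_rfl),
      setLIntegral_congr Ioo_ae_eq_Ioc.symm, lintegral_Iio_zero_eq_Ioi, lintegral_Ioi_one_eq_Ioo,
      lintegral_Ioo_beta_third]
    have hB : 0 < ProbabilityTheory.beta (1 / 3) (1 / 3) :=
      ProbabilityTheory.beta_pos (by norm_num) (by norm_num)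
    rw [← ENNReal.ofReal_add hB.le hB.le, ← ENNReal.ofReal_add hB.le (by positivity)]
    congr 1
    ring
  · intro c v
    rw [← ENNReal.ofReal_pow (abs_nonneg c), ← abs_pow, ← Real.enorm_eq_ofReal_abs, ← enorm_mul]
    congr 1
    simp
    ring

/-! ### From degree `n` to cubics: averaging over permutations -/

theorem prod_perm_comp_apply {n : ℕ} {M : Type*} [CommMonoid M] (g : Fin n → M) (a : Fin n) :
    (∏ σ : Equiv.Perm (Fin n), g (σ a)) ^ n = (∏ i, g i) ^ n.factorial := by
  have h : ∀ b, ∏ σ : Equiv.Perm (Fin n), g (σ b) = ∏ σ : Equiv.Perm (Fin n), g (σ a) := by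
    intro b
    rw [← Equiv.prod_comp (Equiv.mulRight (Equiv.swap a b)) fun σ : Equiv.Perm (Fin n) => g (σ b)]
    simp
  calc (∏ σ : Equiv.Perm (Fin n), g (σ a)) ^ n
      = ∏ b, ∏ σ : Equiv.Perm (Fin n), g (σ b) := by simp [h]
    _ = ∏ σ : Equiv.Perm (Fin n), ∏ b, g (σ b) := Finset.prod_comm
    _ = ∏ σ : Equiv.Perm (Fin n), ∏ b, g b :=
        Finset.prod_congr rfl fun σ _ => Equiv.prod_comp σ g
    _ = _ := by simp [Fintype.card_perm]

theorem prod_perm_comp_apply_rpow {n : ℕ} (g : Fin n → ENNReal) (a : Fin n) :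
    (∏ σ : Equiv.Perm (Fin n), g (σ a)) ^ ((n.factorial : ℝ)⁻¹) = (∏ i, g i) ^ ((n : ℝ)⁻¹) := by
  have hn : (n : ℝ) ≠ 0 := by exact_mod_cast a.pos.ne'
  have hf : (n.factorial : ℝ) ≠ 0 := by exact_mod_cast n.factorial_ne_zero
  have h := congrArg (fun x : ENNReal => x ^ ((n : ℝ)⁻¹ * (n.factorial : ℝ)⁻¹))
    (prod_perm_comp_apply g a)
  simp only [← ENNReal.rpow_natCast, ← ENNReal.rpow_mul] at h
  rwa [mul_inv_cancel_left₀ hn, mul_comm (n : ℝ)⁻¹, mul_inv_cancel_left₀ hf] at h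

theorem enorm_prod_Ioi_wedge_perm {n : ℕ} (p : Fin n → ℂ × ℂ) (σ : Equiv.Perm (Fin n)) :
    ∏ i, ∏ j ∈ Finset.Ioi i, ‖wedge (p (σ i)) (p (σ j))‖ₑ =
      ‖∏ i, ∏ j ∈ Finset.Ioi i, wedge (p i) (p j)‖ₑ := by
  have hprod : ∀ {ι : Type} (s : Finset ι) (f : ι → ℂ), ∏ i ∈ s, ‖f i‖ₑ = ‖∏ i ∈ s, f i‖ₑ := by
    intro ι s f
    simp only [← ofReal_norm, norm_prod]
    exact (ENNReal.ofReal_prod_of_nonneg fun i _ => norm_nonneg _).symm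
  have h := σ.prod_Ioi_comp_eq_sign_mul_prod (f := fun i j => wedge (p i) (p j))
    (fun i j => by simp only [wedge]; ring)
  simp only [hprod, h]
  rcases Int.units_eq_one_or (Equiv.Perm.sign σ) with h | h <;> simp [h]

/-- The symmetric group is 2-transitive, so the product `Q` is the same for every pair of distinct
indices. Multiplying over all pairs gives a power of the square root of the discriminant. -/
theorem one_le_prod_perm_enorm_wedge {n : ℕ} {p : Fin n → ℂ × ℂ}
    (h : 1 ≤ ‖∏ i, ∏ j ∈ Finset.Ioi i, wedge (p i) (p j)‖ₑ) {a b : Fin n} (hab : a ≠ b) :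
    1 ≤ ∏ σ : Equiv.Perm (Fin n), ‖wedge (p (σ a)) (p (σ b))‖ₑ := by
  set Q := ∏ σ : Equiv.Perm (Fin n), ‖wedge (p (σ a)) (p (σ b))‖ₑ with hQ
  have hconst : ∀ i, ∀ j ∈ Finset.Ioi i,
      ∏ σ : Equiv.Perm (Fin n), ‖wedge (p (σ i)) (p (σ j))‖ₑ = Q := by
    intro i j hij
    have htrans := Equiv.Perm.isMultiplyPretransitive (Fin n) 2
    obtain ⟨τ, h1, h2⟩ := MulAction.is_two_pretransitive_iff.1 htrans hab (Finset.mem_Ioi.1 hij).ne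
    rw [hQ, ← Equiv.prod_comp (Equiv.mulRight τ)
      fun σ : Equiv.Perm (Fin n) => ‖wedge (p (σ a)) (p (σ b))‖ₑ]
    rw [Equiv.Perm.smul_def] at h1 h2
    simp [h1, h2]
  have hpow : Q ^ (∑ i : Fin n, (Finset.Ioi i).card) =
      ‖∏ i, ∏ j ∈ Finset.Ioi i, wedge (p i) (p j)‖ₑ ^ n.factorial := by
    calc _ = ∏ i : Fin n, ∏ j ∈ Finset.Ioi i, Q := by
          simp only [Finset.prod_const, Finset.prod_pow_eq_pow_sum]
      _ = ∏ i, ∏ j ∈ Finset.Ioi i,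
          ∏ σ : Equiv.Perm (Fin n), ‖wedge (p (σ i)) (p (σ j))‖ₑ :=
          Finset.prod_congr rfl fun i _ => Finset.prod_congr rfl fun j hj => (hconst i j hj).symm
      _ = ∏ σ : Equiv.Perm (Fin n), ∏ i, ∏ j ∈ Finset.Ioi i,
          ‖wedge (p (σ i)) (p (σ j))‖ₑ := by
          simp_rw [Finset.prod_comm (s := Finset.univ (α := Equiv.Perm (Fin n)))]
      _ = _ := by
          simp only [enorm_prod_Ioi_wedge_perm]
          simp [Fintype.card_perm]
  have hcard : ∑ i : Fin n, (Finset.Ioi i).card ≠ 0 := by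
    intro h0
    rw [Finset.sum_eq_zero_iff] at h0
    rcases lt_or_gt_of_ne hab with hlt | hlt
    · exact (Finset.card_pos.2 ⟨b, Finset.mem_Ioi.2 hlt⟩).ne' (h0 a (Finset.mem_univ _))
    · exact (Finset.card_pos.2 ⟨a, Finset.mem_Ioi.2 hlt⟩).ne' (h0 b (Finset.mem_univ _))
  exact (one_le_pow_iff hcard).1 (hpow ▸ one_le_pow₀ h)

/-- Hölder with equal weights `1/n!`, applied to the cubic integrands `J σ` of the permuted factors
at three fixed positions `a`, `b`, `c`. -/
theorem volume_prod_wedge_le_of_one_le_discr {n : ℕ} (hn : 3 ≤ n) (p : Fin n → ℂ × ℂ)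
    (h : 1 ≤ ‖∏ i, ∏ j ∈ Finset.Ioi i, wedge (p i) (p j)‖ₑ) {K : ENNReal}
    (hK : ∀ p q r, tripleIntegral p q r ≤ K) :
    volume {v : Fin 2 → ℝ | ∏ i, ‖wedge (p i) ((v 1 : ℂ), (v 0 : ℂ))‖ₑ ≤ 1} ≤ K := by
  obtain ⟨a, b, c, hab, hac, hbc⟩ : ∃ a b c : Fin n, a ≠ b ∧ a ≠ c ∧ b ≠ c :=
    ⟨⟨0, by lia⟩, ⟨1, by lia⟩, ⟨2, by lia⟩, by simp, by simp, by simp⟩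
  have hf : (n.factorial : ℝ) ≠ 0 := by exact_mod_cast n.factorial_ne_zero
  set w : ℝ := (n.factorial : ℝ)⁻¹ with hw
  have hw0 : 0 ≤ w := by positivity
  have hwsum : ∑ _σ : Equiv.Perm (Fin n), w = 1 := by
    simp [Fintype.card_perm, hw, hf]
  set J : Equiv.Perm (Fin n) → ℝ → ENNReal := fun σ s =>
    ‖wedge (p (σ a)) (p (σ b))‖ₑ ^ (1 / 3 : ℝ) * ‖wedge (p (σ a)) (p (σ c))‖ₑ ^ (1 / 3 : ℝ) *
      ‖wedge (p (σ a)) (1, (s : ℂ))‖ₑ ^ (-(2 / 3) : ℝ) *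
    (‖wedge (p (σ b)) (p (σ c))‖ₑ ^ (1 / 3 : ℝ) *
      ‖wedge (p (σ b)) (1, (s : ℂ))‖ₑ ^ (-(2 / 3) : ℝ) *
      ‖wedge (p (σ c)) (1, (s : ℂ))‖ₑ ^ (-(2 / 3) : ℝ)) with hJ
  have hpt : ∀ s : ℝ, ∏ i, ‖wedge (p i) (1, (s : ℂ))‖ₑ ^ (-(2 / n : ℝ)) ≤ ∏ σ, J σ s ^ w := by
    intro s
    have hg : ∀ i : Fin n, (∏ σ : Equiv.Perm (Fin n),
        ‖wedge (p (σ i)) (1, (s : ℂ))‖ₑ ^ (-(2 / 3) : ℝ)) ^ w =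
        (∏ i, ‖wedge (p i) (1, (s : ℂ))‖ₑ ^ (-(2 / 3) : ℝ)) ^ ((n : ℝ)⁻¹) :=
      fun i => prod_perm_comp_apply_rpow
        (fun i => ‖wedge (p i) (1, (s : ℂ))‖ₑ ^ (-(2 / 3) : ℝ)) i
    have hW : ∀ {i j : Fin n}, i ≠ j → 1 ≤ ((∏ σ : Equiv.Perm (Fin n),
        ‖wedge (p (σ i)) (p (σ j))‖ₑ) ^ (1 / 3 : ℝ)) ^ w := by
      intro i j hij
      refine ENNReal.one_le_rpow (ENNReal.one_le_rpow (one_le_prod_perm_enorm_wedge h hij)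
        (by norm_num)) (by positivity)
    rw [ENNReal.prod_rpow_of_nonneg hw0]
    simp only [hJ, Finset.prod_mul_distrib, ENNReal.mul_rpow_of_nonneg _ _ hw0, hg]
    rw [ENNReal.prod_rpow_of_nonneg (by norm_num : (0 : ℝ) ≤ 1 / 3),
      ENNReal.prod_rpow_of_nonneg (by norm_num : (0 : ℝ) ≤ 1 / 3),
      ENNReal.prod_rpow_of_nonneg (by norm_num : (0 : ℝ) ≤ 1 / 3)]
    -- Each of the three positions contributes one `G` to the geometric mean, and `G³` is the
    -- integrand of the whole form; the determinants contribute factors at least `1`.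
    set G := (∏ i, ‖wedge (p i) (1, (s : ℂ))‖ₑ ^ (-(2 / 3) : ℝ)) ^ ((n : ℝ)⁻¹) with hG
    have hGe : ∏ i, ‖wedge (p i) (1, (s : ℂ))‖ₑ ^ (-(2 / n : ℝ)) = G * (G * G) := by
      rw [hG, ← ENNReal.prod_rpow_of_nonneg (by positivity), ← pow_two, ← pow_succ',
        ← Finset.prod_pow]
      refine Finset.prod_congr rfl fun i _ => ?_
      rw [← ENNReal.rpow_natCast, ← ENNReal.rpow_mul, ← ENNReal.rpow_mul]
      congr 1
      push_cast
      ring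
    rw [hGe]
    calc G * (G * G) = 1 * 1 * G * (1 * G * G) := by ring
      _ ≤ _ := by
        gcongr
        · exact hW hab
        · exact hW hac
        · exact hW hbc
  rw [volume_prod_enorm_wedge_le_one (by lia)]
  calc _ ≤ ∫⁻ s, ∏ σ, J σ s ^ w := lintegral_mono hpt
    _ ≤ ∏ σ, (∫⁻ s, J σ s) ^ w :=
        ENNReal.lintegral_prod_norm_pow_le _ (fun σ _ => by
          refine Measurable.aemeasurable ?_
          fun_prop) hwsum fun _ _ => hw0
    _ ≤ ∏ _σ : Equiv.Perm (Fin n), K ^ w :=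
        Finset.prod_le_prod' fun σ _ => ENNReal.rpow_le_rpow (hK _ _ _) hw0
    _ = K := by
        rw [Finset.prod_const, ← ENNReal.rpow_natCast, ← ENNReal.rpow_mul, Finset.card_univ,
          Fintype.card_perm, Fintype.card_fin, hw, inv_mul_cancel₀ hf, ENNReal.rpow_one]

/-! ### Integrality of the discriminant -/

theorem norm_prod_offDiag_wedge {n : ℕ} (p : Fin n → ℂ × ℂ) :
    ‖∏ i, ∏ j ∈ ({i}ᶜ : Finset (Fin n)), wedge (p j) (p i)‖ =
      ‖∏ i, ∏ j ∈ Finset.Ioi i, wedge (p i) (p j)‖ ^ 2 := by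
  rw [← Finset.prod_prod_Ioi_mul_eq_prod_prod_off_diag (fun i j => wedge (p i) (p j)), ← norm_pow,
    norm_prod, ← Finset.prod_pow, norm_prod]
  refine Finset.prod_congr rfl fun i _ => ?_
  rw [← Finset.prod_pow, norm_prod, norm_prod]
  refine Finset.prod_congr rfl fun j _ => ?_
  rw [norm_mul, norm_pow, sq]
  congr 1
  rw [← norm_neg]
  congr 1
  simp only [wedge]
  ring

/-- The factor `a i X - b i` contributes `a i ^ (n - 1)` times the derivative at the root `b i / a
i`. These powers of `a i` clear the denominators, leaving the determinants and one extra `a i`. -/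
theorem resultant_derivative_prod_linear {n : ℕ} (a b : Fin n → ℂ) (ha : ∀ i, a i ≠ 0) :
    (∏ i, (Polynomial.C (a i) * Polynomial.X - Polynomial.C (b i))).resultant
      (∏ i, (Polynomial.C (a i) * Polynomial.X - Polynomial.C (b i))).derivative n (n - 1) =
      (∏ i, a i) * ∏ i, ∏ j ∈ ({i}ᶜ : Finset (Fin n)), wedge (a j, b j) (a i, b i) := by
  set l : Fin n → Polynomial ℂ := fun i => Polynomial.C (a i) * Polynomial.X - Polynomial.C (b i)
    with hl
  have hdeg : ∀ i, (l i).natDegree = 1 := fun i => by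
    simp only [hl, sub_eq_add_neg, ← map_neg]
    exact Polynomial.natDegree_linear (ha i)
  have hlead : ∀ i, (l i).leadingCoeff = a i := fun i => by
    simp only [hl, sub_eq_add_neg, ← map_neg]
    exact Polynomial.leadingCoeff_linear (ha i)
  have hne : ∏ i, (l i).leadingCoeff ≠ 0 := by
    simp only [hlead]
    exact Finset.prod_ne_zero_iff.2 fun i _ => ha i
  have hn : (∏ i, l i).natDegree = n := by
    rw [Polynomial.natDegree_prod' _ _ hne]
    simp [hdeg]
  have hd : (∏ i, l i).derivative.natDegree ≤ n - 1 := by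
    have := Polynomial.natDegree_derivative_le (∏ i, l i)
    rwa [hn] at this
  have h := Polynomial.resultant_prod_left Finset.univ l (∏ i, l i).derivative (n - 1) hne hd
  rw [hn] at h
  rw [h, ← Finset.prod_mul_distrib]
  refine Finset.prod_congr rfl fun i _ => ?_
  have hli : l i = Polynomial.C (a i) * (Polynomial.X - Polynomial.C (b i / a i)) := by
    simp only [hl]
    rw [mul_sub, ← Polynomial.C_mul, mul_div_cancel₀ _ (ha i)]
  have hroot : (l i).eval (b i / a i) = 0 := by
    rw [hli]
    simp
  have hder : (∏ i, l i).derivative.eval (b i / a i) =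
      a i * ∏ j ∈ ({i}ᶜ : Finset (Fin n)), (a j * (b i / a i) - b j) := by
    rw [Fintype.prod_eq_mul_prod_compl i, Polynomial.derivative_mul, Polynomial.eval_add,
      Polynomial.eval_mul, Polynomial.eval_mul, hroot, zero_mul, add_zero, Polynomial.eval_prod]
    simp [hl]
  rw [hdeg, hli, Polynomial.resultant_C_mul_left, Polynomial.resultant_X_sub_C_left _ _ _ hd, hder,
    mul_left_comm]
  congr 1
  have hcard : n - 1 = ({i}ᶜ : Finset (Fin n)).card := by
    rw [Finset.card_compl]
    simp
  rw [hcard, ← Finset.prod_const, ← Finset.prod_mul_distrib]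
  refine Finset.prod_congr rfl fun j _ => ?_
  simp only [wedge]
  field_simp [ha i]

/-- Up to sign the resultant of `f` and `f'` is the leading coefficient times `f.discr`. Comparison
with the product formula shows that the squared norm is `|f.discr|`, a non-zero integer. -/
theorem one_le_norm_discr_of_map_eq_prod {n : ℕ} (hn : 0 < n) {f : Polynomial ℤ} {a b : Fin n → ℂ}
    (ha : ∀ i, a i ≠ 0)
    (hf : f.map (Int.castRingHom ℂ) =
      ∏ i, (Polynomial.C (a i) * Polynomial.X - Polynomial.C (b i)))
    (h0 : ∏ i, ∏ j ∈ Finset.Ioi i, wedge (a i, b i) (a j, b j) ≠ 0) :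
    1 ≤ ‖∏ i, ∏ j ∈ Finset.Ioi i, wedge (a i, b i) (a j, b j)‖ := by
  have hinj : Function.Injective (Int.castRingHom ℂ) := Int.cast_injective
  have hlead : ∀ i, (Polynomial.C (a i) * Polynomial.X - Polynomial.C (b i)).leadingCoeff = a i :=
    fun i => by
      simp only [sub_eq_add_neg, ← map_neg]
      exact Polynomial.leadingCoeff_linear (ha i)
  have hdeg : ∀ i, (Polynomial.C (a i) * Polynomial.X - Polynomial.C (b i)).natDegree = 1 :=
    fun i => by
      simp only [sub_eq_add_neg, ← map_neg]
      exact Polynomial.natDegree_linear (ha i)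
  have hprod : ∏ i, a i ≠ 0 := Finset.prod_ne_zero_iff.2 fun i _ => ha i
  have hnat : f.natDegree = n := by
    rw [← Polynomial.natDegree_map_eq_of_injective hinj, hf, Polynomial.natDegree_prod']
    · simp [hdeg]
    · simpa only [hlead] using hprod
  have hlc : (f.leadingCoeff : ℂ) = ∏ i, a i := by
    have := Polynomial.leadingCoeff_map_of_injective hinj f
    rw [hf, Polynomial.leadingCoeff_prod] at this
    simp only [hlead] at this
    exact this.symm
  have hres := Polynomial.resultant_deriv (f := f)
    (Polynomial.natDegree_pos_iff_degree_pos.1 (hnat ▸ hn))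
  have hres' := congrArg (Int.castRingHom ℂ) hres
  rw [← Polynomial.resultant_map_map, ← Polynomial.derivative_map, hf, hnat,
    resultant_derivative_prod_linear a b ha] at hres'
  simp only [map_mul, map_pow, map_neg, map_one, eq_intCast, hlc] at hres'
  have hnorm := congrArg norm hres'
  rw [norm_mul, norm_mul, norm_mul, norm_pow, norm_neg, norm_one, one_pow, one_mul,
    mul_right_inj' (norm_ne_zero_iff.2 hprod),
    norm_prod_offDiag_wedge (fun i => (a i, b i))] at hnorm
  have hd : f.discr ≠ 0 := by
    intro hd
    rw [hd, Int.cast_zero, norm_zero] at hnorm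
    exact h0 (norm_eq_zero.1 (pow_eq_zero_iff two_ne_zero |>.1 hnorm))
  have h1 : (1 : ℝ) ≤ ‖(f.discr : ℂ)‖ := by
    rw [Complex.norm_intCast]
    exact_mod_cast Int.one_le_abs hd
  rw [← hnorm] at h1
  exact (one_le_pow_iff_of_nonneg (norm_nonneg _) two_ne_zero).1 h1

/-- Each index excludes at most one integer. -/
theorem exists_int_forall_sub_mul_ne_zero {n : ℕ} {a b : Fin n → ℂ}
    (h : ∀ i, a i ≠ 0 ∨ b i ≠ 0) : ∃ k : ℤ, ∀ i, a i - k * b i ≠ 0 := by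
  have hfin : (⋃ i, {k : ℤ | a i - k * b i = 0}).Finite := by
    refine Set.finite_iUnion fun i => Set.Subsingleton.finite fun k hk m hm => ?_
    simp only [Set.mem_ofPred_eq] at hk hm
    by_contra hkm
    have hkm' : (k : ℂ) - m ≠ 0 := sub_ne_zero.2 (by exact_mod_cast hkm)
    have hb : b i = 0 := by
      refine (mul_eq_zero.1 (?_ : ((k : ℂ) - m) * b i = 0)).resolve_left hkm'
      linear_combination hm - hk
    have ha : a i = 0 := by simpa [hb] using hk
    exact (h i).elim (fun h => h ha) fun h => h hb
  obtain ⟨k, hk⟩ := hfin.exists_notMem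
  refine ⟨k, fun i hi => hk (Set.mem_iUnion.2 ⟨i, hi⟩)⟩

theorem one_le_norm_prod_wedge {n : ℕ} (hn : 2 ≤ n) {F : MvPolynomial (Fin 2) ℤ}
    {α β : Fin n → ℂ}
    (hF : map (Int.castRingHom ℂ) F = ∏ i, (C (α i) * X 0 - C (β i) * X 1))
    (h0 : ∏ i, ∏ j ∈ Finset.Ioi i, wedge (α i, β i) (α j, β j) ≠ 0) :
    1 ≤ ‖∏ i, ∏ j ∈ Finset.Ioi i, wedge (α i, β i) (α j, β j)‖ := by
  have hne : ∀ i, α i ≠ 0 ∨ β i ≠ 0 := by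
    intro i
    by_contra! hi
    have : Nontrivial (Fin n) := Fin.nontrivial_iff_two_le.2 hn
    obtain ⟨j, hj⟩ := exists_ne i
    have hw : ∀ k, wedge (α i, β i) (α k, β k) = 0 ∧ wedge (α k, β k) (α i, β i) = 0 := by
      simp [wedge, hi]
    refine h0 ?_
    rcases lt_or_gt_of_ne hj with hlt | hlt
    · exact Finset.prod_eq_zero (Finset.mem_univ j)
        (Finset.prod_eq_zero (Finset.mem_Ioi.2 hlt) (hw j).2)
    · exact Finset.prod_eq_zero (Finset.mem_univ i)
        (Finset.prod_eq_zero (Finset.mem_Ioi.2 hlt) (hw j).1)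
  obtain ⟨k, hk⟩ := exists_int_forall_sub_mul_ne_zero hne
  have hwedge : ∀ i j, wedge (α i - k * β i, β i) (α j - k * β j, β j) =
      wedge (α i, β i) (α j, β j) := by
    intro i j
    simp only [wedge]
    ring
  -- Setting `Y = 1 + k X` turns `α X - β Y` into `(α - k β) X - β`. By the choice of `k` no factor
  -- drops in degree, and the shear preserves all determinants.
  set f : Polynomial ℤ := aeval ![Polynomial.X, 1 + Polynomial.C k * Polynomial.X] F with hf
  have hmap : ∀ G : MvPolynomial (Fin 2) ℤ,
      (aeval ![Polynomial.X, 1 + Polynomial.C k * Polynomial.X] G : Polynomial ℤ).map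
        (Int.castRingHom ℂ) =
      aeval ![Polynomial.X, 1 + Polynomial.C (k : ℂ) * Polynomial.X]
        (map (Int.castRingHom ℂ) G) := by
    intro G
    induction G using MvPolynomial.induction_on with
    | C a => simp
    | add p q hp hq => rw [map_add, Polynomial.map_add, hp, hq, map_add, map_add]
    | mul_X p i hp =>
      rw [map_mul, Polynomial.map_mul, hp, map_mul, map_mul]
      fin_cases i <;> simp
  have hfmap : f.map (Int.castRingHom ℂ) = ∏ i, (Polynomial.C (α i - k * β i) * Polynomial.X -
      Polynomial.C (β i)) := by
    rw [hf, hmap, hF, map_prod]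
    refine Finset.prod_congr rfl fun i _ => ?_
    simp [Polynomial.algebraMap_eq]
    ring
  have := one_le_norm_discr_of_map_eq_prod (by lia) hk hfmap (by simpa only [hwedge] using h0)
  simpa only [hwedge] using this

/-! ### Numerical value of `B(1/3,1/3)` -/

/-- The Taylor coefficients of `(1 - x) ^ (-2/3)`. -/
noncomputable def twoThirdsCoeff (k : ℕ) : ℝ := ∏ j ∈ Finset.range k, ((j + 2 / 3 : ℝ) / (j + 1))

theorem twoThirdsCoeff_succ (k : ℕ) :
    twoThirdsCoeff (k + 1) = twoThirdsCoeff k * ((k + 2 / 3 : ℝ) / (k + 1)) :=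
  Finset.prod_range_succ _ _

theorem twoThirdsCoeff_nonneg (k : ℕ) : 0 ≤ twoThirdsCoeff k :=
  Finset.prod_nonneg fun j _ => by positivity

theorem twoThirdsCoeff_antitone : Antitone twoThirdsCoeff := by
  refine antitone_nat_of_succ_le fun k => ?_
  rw [twoThirdsCoeff_succ]
  refine mul_le_of_le_one_right (twoThirdsCoeff_nonneg k) ?_
  rw [div_le_one (by positivity)]
  linarith

theorem choose_eq_twoThirdsCoeff (k : ℕ) :
    Ring.choose ((2 / 3 : ℝ) + k - 1) k = twoThirdsCoeff k := by
  rw [← Ring.multichoose_eq]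
  have h : ∀ m : ℕ, (ascPochhammer ℕ m).smeval (2 / 3 : ℝ) = m.factorial * twoThirdsCoeff m := by
    intro m
    induction m with
    | zero => simp [twoThirdsCoeff]
    | succ m ih =>
      rw [Polynomial.ascPochhammer_smeval_eq_eval] at ih ⊢
      rw [ascPochhammer_succ_eval, ih, twoThirdsCoeff_succ, Nat.factorial_succ]
      push_cast
      field_simp
      ring
  have h' := (Ring.factorial_nsmul_multichoose_eq_ascPochhammer (2 / 3 : ℝ) k).trans (h k)
  rw [nsmul_eq_mul] at h'
  exact mul_left_cancel₀ (by exact_mod_cast k.factorial_ne_zero) h'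

theorem hasSum_one_sub_rpow {x : ℝ} (h0 : 0 ≤ x) (h1 : x < 1) :
    HasSum (fun k => twoThirdsCoeff k * x ^ k) ((1 - x) ^ (-(2 / 3) : ℝ)) := by
  have h := (Real.one_div_one_sub_rpow_hasFPowerSeriesOnBall_zero (2 / 3)).hasSum
    (y := x) (by simpa [enorm_eq_nnnorm, ← NNReal.coe_lt_coe, abs_of_nonneg h0] using h1)
  simp only [choose_eq_twoThirdsCoeff, FormalMultilinearSeries.ofScalars_apply_eq, smul_eq_mul,
    zero_add] at h
  rwa [one_div, ← Real.rpow_neg (by linarith)] at h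

theorem sum_le_one_sub_rpow {x : ℝ} (h0 : 0 ≤ x) (h1 : x < 1) (K : ℕ) :
    ∑ k ∈ Finset.range K, twoThirdsCoeff k * x ^ k ≤ (1 - x) ^ (-(2 / 3) : ℝ) :=
  sum_le_hasSum _ (fun k _ => mul_nonneg (twoThirdsCoeff_nonneg k) (pow_nonneg h0 k))
    (hasSum_one_sub_rpow h0 h1)

/-- The coefficients decrease, so the tail is dominated by a geometric series, whose sum carries a
factor `1/(1-x) ≤ 2`. -/
theorem one_sub_rpow_le_sum {x : ℝ} (h0 : 0 ≤ x) (h1 : x ≤ 1 / 2) (K : ℕ) :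
    (1 - x) ^ (-(2 / 3) : ℝ) ≤
      ∑ k ∈ Finset.range K, twoThirdsCoeff k * x ^ k + 2 * twoThirdsCoeff K * x ^ K := by
  have hs := hasSum_one_sub_rpow h0 (by linarith)
  have htail := (hasSum_nat_add_iff' K).2 hs
  have hgeo := (hasSum_geometric_of_lt_one h0 (by linarith)).mul_left (twoThirdsCoeff K * x ^ K)
  have hle := hasSum_le (fun j => by
    rw [pow_add, mul_comm (x ^ j), ← mul_assoc]
    exact mul_le_mul_of_nonneg_right (mul_le_mul_of_nonneg_right
      (twoThirdsCoeff_antitone (Nat.le_add_left K j)) (pow_nonneg h0 K)) (pow_nonneg h0 j))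
    htail hgeo
  have h2 : (1 - x)⁻¹ ≤ 2 := by
    rw [inv_le_comm₀ (by linarith) two_pos]
    linarith
  have h3 := mul_le_mul_of_nonneg_left h2
    (mul_nonneg (twoThirdsCoeff_nonneg K) (pow_nonneg h0 K))
  linarith

theorem lintegral_Ioo_sum_rpow {e : ℕ → ℝ} (he : ∀ k, 0 ≤ e k) (K : ℕ) :
    ∫⁻ x in Set.Ioo (0 : ℝ) (1 / 2),
        ENNReal.ofReal (x ^ (-(2 / 3) : ℝ) * ∑ k ∈ Finset.range K, e k * x ^ k) =
      ENNReal.ofReal ((1 / 2 : ℝ) ^ (1 / 3 : ℝ) *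
        ∑ k ∈ Finset.range K, e k * ((1 / 2) ^ k / (k + 1 / 3))) := by
  have hmono : ∀ k : ℕ, ∫⁻ x in Set.Ioo (0 : ℝ) (1 / 2), ENNReal.ofReal (x ^ (k - 2 / 3 : ℝ)) =
      ENNReal.ofReal ((1 / 2 : ℝ) ^ (1 / 3 : ℝ) * ((1 / 2) ^ k / (k + 1 / 3))) := by
    intro k
    have hk : (-1 : ℝ) < k - 2 / 3 := by
      have : (0 : ℝ) ≤ k := k.cast_nonneg
      linarith
    have hint := intervalIntegral.intervalIntegrable_rpow' (a := 0) (b := 1 / 2) hk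
    rw [intervalIntegrable_iff_integrableOn_Ioo_of_le (by norm_num)] at hint
    rw [← ofReal_integral_eq_lintegral_ofReal hint]
    · rw [← integral_Ioc_eq_integral_Ioo, ← intervalIntegral.integral_of_le (by norm_num),
        integral_rpow (.inl hk)]
      have e1 : (k - 2 / 3 + 1 : ℝ) = 1 / 3 + k := by ring
      rw [e1, Real.zero_rpow (by positivity), Real.rpow_add (by norm_num), Real.rpow_natCast]
      congr 1
      ring
    · exact ae_restrict_of_forall_mem measurableSet_Ioo fun x hx => Real.rpow_nonneg hx.1.le _
  calc _ = ∫⁻ x in Set.Ioo (0 : ℝ) (1 / 2),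
        ∑ k ∈ Finset.range K, ENNReal.ofReal (e k) * ENNReal.ofReal (x ^ (k - 2 / 3 : ℝ)) := by
        refine setLIntegral_congr_fun measurableSet_Ioo fun x hx => ?_
        rw [Finset.mul_sum, ENNReal.ofReal_sum_of_nonneg fun k _ => mul_nonneg
          (Real.rpow_nonneg hx.1.le _) (mul_nonneg (he k) (pow_nonneg hx.1.le k))]
        refine Finset.sum_congr rfl fun k _ => ?_
        rw [← ENNReal.ofReal_mul (he k), sub_eq_neg_add, Real.rpow_add hx.1, Real.rpow_natCast]
        congr 1
        ring
    _ = ∑ k ∈ Finset.range K, ENNReal.ofReal (e k) *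
          ENNReal.ofReal ((1 / 2 : ℝ) ^ (1 / 3 : ℝ) * ((1 / 2) ^ k / (k + 1 / 3))) := by
        rw [lintegral_finsetSum _ fun k _ => by fun_prop]
        refine Finset.sum_congr rfl fun k _ => ?_
        rw [lintegral_const_mul _ (by fun_prop), hmono]
    _ = _ := by
        rw [Finset.mul_sum, ENNReal.ofReal_sum_of_nonneg fun k _ => mul_nonneg (by positivity)
          (mul_nonneg (he k) (by positivity))]
        refine Finset.sum_congr rfl fun k _ => ?_
        rw [← ENNReal.ofReal_mul (he k)]
        congr 1
        ring

/-- The symmetry `x ↦ 1 - x` confines the integral to `x < 1/2`, where the binomial series converges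
geometrically. -/
theorem ofReal_beta_third_eq_half :
    ENNReal.ofReal (ProbabilityTheory.beta (1 / 3) (1 / 3)) = 2 *
      ∫⁻ x in Set.Ioo (0 : ℝ) (1 / 2),
        ENNReal.ofReal (x ^ (-(2 / 3) : ℝ) * (1 - x) ^ (-(2 / 3) : ℝ)) := by
  have himg : (fun x : ℝ => 1 - x) '' Set.Ioo 0 (1 / 2) = Set.Ioo (1 / 2) 1 := by
    simp
    norm_num
  have hd : ∀ x, HasDerivWithinAt (fun x : ℝ => 1 - x) (-1) (Set.Ioo 0 (1 / 2)) x :=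
    fun x => ((hasDerivAt_id x).const_sub 1).hasDerivWithinAt
  have hflip : ∫⁻ s in Set.Ioo (1 / 2 : ℝ) 1, ‖s * (s - 1)‖ₑ ^ (-(2 / 3) : ℝ) =
      ∫⁻ s in Set.Ioo (0 : ℝ) (1 / 2), ‖s * (s - 1)‖ₑ ^ (-(2 / 3) : ℝ) := by
    rw [← himg, lintegral_image_eq_lintegral_abs_deriv_mul measurableSet_Ioo
      (fun x _ => hd x) (sub_right_injective.injOn)]
    refine setLIntegral_congr_fun measurableSet_Ioo fun x _ => ?_
    have e : (1 - x) * (1 - x - 1) = x * (x - 1) := by ring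
    simp only [e]
    simp
  rw [← lintegral_Ioo_beta_third, ← Set.Ioc_union_Ioo_eq_Ioo (b := (1 / 2 : ℝ)) (by norm_num)
    (by norm_num), lintegral_union measurableSet_Ioo
    (Set.disjoint_left.2 fun x hx hx' => absurd hx.2 (not_le.2 hx'.1)),
    setLIntegral_congr Ioo_ae_eq_Ioc.symm, hflip, ← two_mul]
  congr 1
  refine setLIntegral_congr_fun measurableSet_Ioo fun x hx => ?_
  have h1 : 0 < 1 - x := by linarith [hx.2]
  have : ‖x * (x - 1)‖ₑ = ‖x * (1 - x)‖ₑ := by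
    rw [← enorm_neg]
    congr 1
    ring
  simp only [this]
  rw [enorm_rpow_eq_ofReal (mul_pos hx.1 h1), Real.mul_rpow hx.1.le h1.le]

theorem beta_third_bounds (K : ℕ) :
    2 * ((1 / 2 : ℝ) ^ (1 / 3 : ℝ) *
        ∑ k ∈ Finset.range K, twoThirdsCoeff k * ((1 / 2) ^ k / (k + 1 / 3))) ≤
      ProbabilityTheory.beta (1 / 3) (1 / 3) ∧
    ProbabilityTheory.beta (1 / 3) (1 / 3) ≤ 2 * ((1 / 2 : ℝ) ^ (1 / 3 : ℝ) *
      (∑ k ∈ Finset.range K, twoThirdsCoeff k * ((1 / 2) ^ k / (k + 1 / 3)) +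
        2 * twoThirdsCoeff K * ((1 / 2) ^ K / (K + 1 / 3)))) := by
  have hB : 0 < ProbabilityTheory.beta (1 / 3) (1 / 3) :=
    ProbabilityTheory.beta_pos (by norm_num) (by norm_num)
  have hc := twoThirdsCoeff_nonneg
  constructor
  · rw [← ENNReal.ofReal_le_ofReal_iff hB.le, ENNReal.ofReal_mul two_pos.le, ENNReal.ofReal_ofNat,
      ← lintegral_Ioo_sum_rpow hc, ofReal_beta_third_eq_half]
    gcongr 2 * ?_
    refine setLIntegral_mono' measurableSet_Ioo fun x hx => ENNReal.ofReal_le_ofReal ?_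
    exact mul_le_mul_of_nonneg_left (sum_le_one_sub_rpow hx.1.le (by linarith [hx.2]) K)
      (Real.rpow_nonneg hx.1.le _)
  -- Doubling the coefficient of index `K` absorbs the tail bound, so the upper estimate is again a
  -- finite sum of the same shape.
  · set e : ℕ → ℝ := fun k => if k < K then twoThirdsCoeff k else 2 * twoThirdsCoeff k with he
    have he0 : ∀ k, 0 ≤ e k := by
      intro k
      have := hc k
      simp only [he]
      split_ifs <;> positivity
    have hsum : ∀ g : ℕ → ℝ, ∑ k ∈ Finset.range (K + 1), e k * g k =
        ∑ k ∈ Finset.range K, twoThirdsCoeff k * g k + 2 * twoThirdsCoeff K * g K := by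
      intro g
      rw [Finset.sum_range_succ]
      congr 1
      · refine Finset.sum_congr rfl fun k hk => ?_
        simp [he, Finset.mem_range.1 hk]
      · simp [he]
    rw [← hsum fun k => (1 / 2 : ℝ) ^ k / (k + 1 / 3), ← ENNReal.ofReal_le_ofReal_iff (by
      refine mul_nonneg two_pos.le (mul_nonneg (by positivity) (Finset.sum_nonneg fun k _ =>
        mul_nonneg (he0 k) (by positivity)))), ENNReal.ofReal_mul two_pos.le, ENNReal.ofReal_ofNat,
      ← lintegral_Ioo_sum_rpow he0, ofReal_beta_third_eq_half]
    gcongr 2 * ?_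
    refine setLIntegral_mono' measurableSet_Ioo fun x hx => ENNReal.ofReal_le_ofReal ?_
    rw [hsum]
    exact mul_le_mul_of_nonneg_left (one_sub_rpow_le_sum hx.1.le hx.2.le K)
      (Real.rpow_nonneg hx.1.le _)

theorem abs_three_mul_beta_third_sub_lt :
    |3 * ProbabilityTheory.beta (1 / 3) (1 / 3) - 15.8997| < 0.00005 := by
  -- The value `15.8997487…` is only about `1.2 · 10⁻⁶` below the upper limit `15.89975`; this calls
  -- for a remainder and an enclosure of `2^(-1/3)` of comparable precision.
  obtain ⟨hl, hu⟩ := beta_third_bounds 19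
  set t : ℝ := (1 / 2 : ℝ) ^ (1 / 3 : ℝ) with ht
  have ht0 : 0 ≤ t := by positivity
  have ht3 : t ^ 3 = 1 / 2 := by
    rw [ht, ← Real.rpow_natCast, ← Real.rpow_mul (by norm_num)]
    norm_num
  have htl : 0.79370052 ≤ t := by
    by_contra! h
    have := pow_lt_pow_left₀ h ht0 three_ne_zero
    rw [ht3] at this
    norm_num at this
  have htu : t ≤ 0.79370053 := by
    by_contra! h
    have := pow_lt_pow_left₀ h (by norm_num) three_ne_zero
    rw [ht3] at this
    norm_num at this
  have hsl : (15.89965 : ℝ) < 6 * (0.79370052 * ∑ k ∈ Finset.range 19,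
      twoThirdsCoeff k * ((1 / 2) ^ k / (k + 1 / 3))) := by
    simp only [twoThirdsCoeff, Finset.sum_range_succ, Finset.prod_range_succ,
      Finset.sum_range_zero, Finset.prod_range_zero]
    norm_num
  have hsu : 6 * (0.79370053 * (∑ k ∈ Finset.range 19,
      twoThirdsCoeff k * ((1 / 2) ^ k / (k + 1 / 3)) +
        2 * twoThirdsCoeff 19 * ((1 / 2) ^ 19 / ((19 : ℕ) + 1 / 3)))) < (15.89975 : ℝ) := by
    simp only [twoThirdsCoeff, Finset.sum_range_succ, Finset.prod_range_succ,
      Finset.sum_range_zero, Finset.prod_range_zero]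
    norm_num
  set s := ∑ k ∈ Finset.range 19, twoThirdsCoeff k * ((1 / 2 : ℝ) ^ k / (k + 1 / 3)) with hs
  set r := 2 * twoThirdsCoeff 19 * ((1 / 2 : ℝ) ^ 19 / ((19 : ℕ) + 1 / 3)) with hr
  have hs0 : 0 ≤ s := Finset.sum_nonneg fun k _ =>
    mul_nonneg (twoThirdsCoeff_nonneg k) (by positivity)
  have hr0 : 0 ≤ r := mul_nonneg (mul_nonneg two_pos.le (twoThirdsCoeff_nonneg _)) (by positivity)
  have h1 := mul_le_mul_of_nonneg_right htl hs0
  have h2 := mul_le_mul_of_nonneg_right htu (add_nonneg hs0 hr0)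
  rw [abs_lt]
  constructor
  · norm_num at *
    linarith
  · norm_num at *
    linarith

/-! ### Integer forms: the bound and the case of equality -/

theorem isDiscriminant_iff {n : ℕ} {F : MvPolynomial (Fin 2) ℂ} {D : ℂ} :
    IsDiscriminant n F D ↔ ∃ α β : Fin n → ℂ, F = ∏ i, (C (α i) * X 0 - C (β i) * X 1) ∧
      D = (∏ i, ∏ j ∈ Finset.Ioi i, wedge (α i, β i) (α j, β j)) ^ 2 := by
  have h : ∀ (α β : Fin n → ℂ) i j,
      wedge (α i, β i) (α j, β j) = α i * β j - α j * β i := by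
    intro α β i j
    rw [wedge, mul_comm (β i)]
  simp only [IsDiscriminant, h, ← Finset.prod_pow]

theorem formArea_eq_volume_prod {n : ℕ} {F : MvPolynomial (Fin 2) ℤ} {α β : Fin n → ℂ}
    (hF : map (Int.castRingHom ℂ) F = ∏ i, (C (α i) * X 0 - C (β i) * X 1)) :
    formArea F = volume {v : Fin 2 → ℝ |
      ∏ i, ‖wedge (α i, β i) ((v 1 : ℂ), (v 0 : ℂ))‖ₑ ≤ 1} := by
  have key : ∀ v : Fin 2 → ℝ, ENNReal.ofReal |aeval v F| =
      ∏ i, ‖wedge (α i, β i) ((v 1 : ℂ), (v 0 : ℂ))‖ₑ := by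
    intro v
    have h1 : ((aeval v F : ℝ) : ℂ) = aeval (fun i => (v i : ℂ)) F :=
      (aeval_algebraMap_apply (A := ℝ) ℂ v F).symm
    have h2 : aeval (fun i => (v i : ℂ)) F =
        aeval (fun i => (v i : ℂ)) (map (Int.castRingHom ℂ) F) := by
      rw [aeval_def, aeval_def, eval₂_map]
      congr 1
    rw [← Real.norm_eq_abs, ← Complex.norm_real, h1, h2, hF, map_prod, norm_prod,
      ENNReal.ofReal_prod_of_nonneg fun i _ => norm_nonneg _]
    refine Finset.prod_congr rfl fun i _ => ?_
    rw [ofReal_norm]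
    simp [wedge]
  simp only [formArea, ← key, ENNReal.ofReal_le_one]

theorem formArea_le {n : ℕ} (hn : 3 ≤ n) {F : MvPolynomial (Fin 2) ℤ}
    (hD : HasNonzeroDiscriminant n F) :
    formArea F ≤ ENNReal.ofReal (3 * ProbabilityTheory.beta (1 / 3) (1 / 3)) := by
  obtain ⟨D, hD, hD0⟩ := hD
  obtain ⟨α, β, hF, rfl⟩ := isDiscriminant_iff.1 hD
  have h0 : ∏ i, ∏ j ∈ Finset.Ioi i, wedge (α i, β i) (α j, β j) ≠ 0 :=
    fun h => hD0 (by rw [h]; simp)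
  rw [formArea_eq_volume_prod hF, ← volume_triangleRegion]
  refine volume_prod_wedge_le_of_one_le_discr hn (fun i => (α i, β i)) ?_
    tripleIntegral_le_volume_triangleRegion
  rw [← ofReal_norm]
  exact ENNReal.one_le_ofReal.2 (one_le_norm_prod_wedge (by lia) hF h0)

/-- The three linear factors of `H(aX + bY, cX + dY)`, where `H = XY(X - Y)`. -/
def triangleFactors (T : Matrix (Fin 2) (Fin 2) ℤ) : Fin 3 → ℝ × ℝ :=
  ![((T 0 0 : ℝ), -(T 0 1 : ℝ)), ((T 1 0 : ℝ), -(T 1 1 : ℝ)),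
    ((T 0 0 : ℝ) - T 1 0, (T 1 1 : ℝ) - T 0 1)]

theorem map_formSubst_triangle (T : Matrix (Fin 2) (Fin 2) ℤ) :
    map (Int.castRingHom ℂ) (formSubst T (X 0 * X 1 * (X 0 - X 1))) =
      ∏ i, (C (realPair (triangleFactors T i)).1 * X 0 -
        C (realPair (triangleFactors T i)).2 * X 1) := by
  rw [Fin.prod_univ_three]
  simp only [formSubst, triangleFactors, realPair, map_mul, map_sub, map_add, aeval_X, map_X, map_C,
    Matrix.cons_val, Int.coe_castRingHom]
  push_cast
  simp only [map_neg, map_sub]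
  ring

theorem isHomogeneous_formSubst_triangle (T : Matrix (Fin 2) (Fin 2) ℤ) :
    (formSubst T (X 0 * X 1 * (X 0 - X 1))).IsHomogeneous 3 := by
  have hl : ∀ a b : ℤ, (C a * X 0 + C b * X 1 : MvPolynomial (Fin 2) ℤ).IsHomogeneous 1 :=
    fun a b => (isHomogeneous_C_mul_X a 0).add (isHomogeneous_C_mul_X b 1)
  simp only [formSubst, map_mul, map_sub, aeval_X, Matrix.cons_val_zero, Matrix.cons_val_one]
  exact ((hl _ _).mul (hl _ _)).mul ((hl _ _).sub (hl _ _))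

/-- All pairwise determinants of the three factors are `± det T = ±1`, so the normalizing factor in
`volume_realPair_cubic` is `1` and the area is that of `triangleRegion`. -/
theorem triangle_form_properties {T : Matrix (Fin 2) (Fin 2) ℤ} (hT : IsUnit T.det) :
    HasNonzeroDiscriminant 3 (formSubst T (X 0 * X 1 * (X 0 - X 1))) ∧
    formArea (formSubst T (X 0 * X 1 * (X 0 - X 1))) =
      ENNReal.ofReal (3 * ProbabilityTheory.beta (1 / 3) (1 / 3)) := by
  have hdet : ((T 0 0 : ℝ) * T 1 1 - T 0 1 * T 1 0) ^ 2 = 1 := by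
    have h : (T.det) ^ 2 = 1 := by
      rcases Int.isUnit_iff.1 hT with h | h <;> simp [h]
    rw [Matrix.det_fin_two] at h
    exact_mod_cast h
  set a := triangleFactors T with ha
  set d : ℝ := (T 0 0 : ℝ) * T 1 1 - T 0 1 * T 1 0 with hd
  have h01 : (a 0).1 * (a 1).2 - (a 0).2 * (a 1).1 = -d := by
    simp [ha, triangleFactors, hd]
    ring
  have h12 : (a 1).1 * (a 2).2 - (a 1).2 * (a 2).1 = d := by
    simp [ha, triangleFactors, hd]
    ring
  have h20 : (a 2).1 * (a 0).2 - (a 2).2 * (a 0).1 = -d := by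
    simp [ha, triangleFactors, hd]
    ring
  have h02 : (a 0).1 * (a 2).2 - (a 0).2 * (a 2).1 = d := by linarith
  have hd0 : d ≠ 0 := by
    intro h
    simp [h] at hdet
  have hd1 : |d| = 1 := by
    rw [← sq_eq_sq₀ (abs_nonneg d) zero_le_one, sq_abs, hdet, one_pow]
  have hw : ∀ i j, wedge (realPair (a i)) (realPair (a j)) =
      (((a i).1 * (a j).2 - (a i).2 * (a j).1 : ℝ) : ℂ) := by
    intro i j
    simp [wedge, realPair]
  constructor
  · refine ⟨_, isDiscriminant_iff.2 ⟨_, _, map_formSubst_triangle T, rfl⟩, pow_ne_zero 2 ?_⟩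
    refine Finset.prod_ne_zero_iff.2 fun i _ => Finset.prod_ne_zero_iff.2 fun j hj => ?_
    have h := hw i j
    rw [Finset.mem_Ioi] at hj
    refine (congrArg (· ≠ 0) h).mpr ?_
    rw [Complex.ofReal_ne_zero]
    have hcases : ∀ i j : Fin 3, i < j → (i = 0 ∧ j = 1) ∨ (i = 0 ∧ j = 2) ∨ (i = 1 ∧ j = 2) := by
      decide
    rcases hcases i j hj with ⟨rfl, rfl⟩ | ⟨rfl, rfl⟩ | ⟨rfl, rfl⟩
    · rw [h01]
      exact neg_ne_zero.2 hd0
    · rwa [h02]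
    · rwa [h12]
  · have h := volume_realPair_cubic a (by
      rw [h01, h12, h20]
      exact mul_ne_zero (mul_ne_zero (neg_ne_zero.2 hd0) hd0) (neg_ne_zero.2 hd0))
    simp only [enorm_wedge_realPair, h01, h12, h02, abs_neg, hd1, ENNReal.ofReal_one, one_mul,
      ENNReal.one_rpow] at h
    rw [formArea_eq_volume_prod (map_formSubst_triangle T), ← volume_triangleRegion]
    exact h

theorem theorem1 :
    (∀ (n : ℕ) (F : MvPolynomial (Fin 2) ℤ), 3 ≤ n → F.IsHomogeneous n →
      HasNonzeroDiscriminant n F →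
      formArea F ≤ ENNReal.ofReal (3 * ProbabilityTheory.beta (1 / 3) (1 / 3))) ∧
    (∀ G : MvPolynomial (Fin 2) ℤ,
      GL2ZEquivalent (X 0 * X 1 * (X 0 - X 1)) G →
      G.IsHomogeneous 3 ∧ HasNonzeroDiscriminant 3 G ∧
      formArea G = ENNReal.ofReal (3 * ProbabilityTheory.beta (1 / 3) (1 / 3))) ∧
    |3 * ProbabilityTheory.beta (1 / 3) (1 / 3) - 15.8997| < 0.00005 := by
  refine ⟨fun n F hn _ hD => formArea_le hn hD, ?_, abs_three_mul_beta_third_sub_lt⟩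
  rintro G ⟨T, rfl⟩
  exact ⟨isHomogeneous_formSubst_triangle T.val,
    triangle_form_properties ((Matrix.isUnit_iff_isUnit_det T.val).1 T.isUnit)⟩
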